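/- Let $M>0$ and $\omega>0$ with $\omega M^2<\tfrac12$ (in particular $M=\tfrac12$, $\omega=1$), and let $$f(r)=1+\omega r^2-\sqrt{r(\omega^2r^3+4\omega M)},\qquad r>0,$$ be the metric function of the Kehagias–Sfetsos metric $ds^2=-f\,dt^2+dr^2/f+r^2(d\theta^2+\sin^2\theta\,d\varphi^2)$. Then $f>0$ on $(0,\infty)$, and the tortoise coordinate $r_*=\int_0^r ds/f(s)$ maps $(0,\infty)$ bijectively onto $(0,\infty)$. For $\lambda\in\mathbb R$ let $$V_\pm=\frac{f\lambda^2}{r^2}\pm\lambda\frac{d}{dr_*}\Big(\frac{\sqrt f}{r}\Big),$$ regarded as functions of $x=r_*\in(0,\infty)$. The following holds for every $\lambda\in\mathbb R$ and each choice of sign. (1) Reduction. Consider the massless Chandrasekhar–Dirac equations, written (in signature $(+,-,-,-)$) in the Newman–Penrose tetrad $l=dt-dr/f$, $n=\frac12(f\,dt+dr)$, $m=-\frac r{\sqrt2}(d\theta+i\sin\theta\,d\varphi)$, with non-zero spin coefficients $\beta=-\alpha=\frac{\cot\theta}{2\sqrt2\,r}$, $\rho=-\frac1r$, $\mu=-\frac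 f{2r}$, $\gamma=\frac{f'}4$: $$(D-\rho)F_1+(\bar\delta-\alpha)F_2=0,\qquad (\Delta+\mu-\gamma)F_2+(\delta+\beta)F_1=0,$$ $$(D-\rho)G_2-(\delta-\alpha)G_1=0,\qquad (\Delta+\mu-\gamma)G_1-(\bar\delta+\beta)G_2=0.$$ Suppose they are solved on $r>0$, $0<\theta<\pi$ by $$F_1=e^{i(kt+m\varphi)}\tfrac{R_1S_1}{r},\quad F_2=e^{i(kt+m\varphi)}\tfrac{\sqrt2R_2S_2}{r\sqrt f},\quad G_1=e^{i(kt+m\varphi)}\tfrac{\sqrt2R_2S_1}{r\sqrt f},\quad G_2=e^{i(kt+m\varphi)}\tfrac{R_1S_2}{r},$$ where $k,m\in\mathbb R$, $R_1(r),R_2(r)$ are differentiable, and $S_1(\theta),S_2(\theta)$ are differentiable, not both identically zero, and satisfy $S_1'+(\frac12\cot\theta-\frac m{\sin\theta})S_1=\lambda S_2$ and $S_2'+(\frac12\cot\theta+\frac m{\sin\theta})S_2=-\lambda S_1$. Then $Z_\pm=R_1\pm R_2$ satisfies $$\Big(\frac{d^2}{dr_*^2}+k^2\Big)Z_\pm=V_\pm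 Z_\pm .$$ (2) $V_\pm$ is continuous on $(0,\infty)$ and is in the limit point case at $\infty$. (3) If $\lambda^2\mp\lambda\ge\frac34$, then $V_\pm$ is also in the limit point case at $0$, and the radial operator $A=-\frac{d^2}{dr_*^2}+V_\pm$ with domain $C_c^\infty(0,\infty)$ in $L^2((0,\infty),dr_*)$ is essentially self-adjoint: its closure is self-adjoint and its deficiency indices are $(0,0)$. Hence $A$ has exactly one self-adjoint extension, that is, the naked singularity is quantum-regular (in the sense of Horowitz and Marolf) for this fermion mode. Here a potential is in the limit circle case at $\infty$ (at $0$) if for some $z\in\mathbb C$ all solutions of $-\psi''+V\psi=z\psi$ on $(0,\infty)$ are square integrable near $\infty$ (near $0$), and in the limit point case otherwise. -/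

import Mathlib

open Set MeasureTheory Filter Topology
open scoped ContDiff Distributions ENNReal

noncomputable section

namespace KSDirac

/-! ## Schroedinger operators on the half-line -/

/-- The Hilbert space `L²((0,∞), dx)` of complex functions. -/
abbrev L2HalfLine : Type := Lp ℂ 2 (volume.restrict (Ioi (0 : ℝ)))

/-- The open half-line `(0,∞)`. -/
def halfLine : TopologicalSpace.Opens ℝ := ⟨Ioi 0, isOpen_Ioi⟩

theorem memLp_testFunction (φ : 𝓓(halfLine, ℂ)) :
    MemLp φ 2 (volume.restrict (Ioi (0 : ℝ))) :=
  φ.continuous.memLp_of_hasCompactSupport φ.hasCompactSupport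

/-- The inclusion of `C_c^∞(0,∞)` into `L²(0,∞)`. -/
def testToL2 : 𝓓(halfLine, ℂ) →ₗ[ℂ] L2HalfLine where
  toFun φ := (memLp_testFunction φ).toLp φ
  map_add' _ _ := rfl
  map_smul' _ _ := rfl

theorem testToL2_injective : Function.Injective testToL2 := by
  intro φ ψ h
  have h1 : (φ : ℝ → ℂ) =ᵐ[volume.restrict (Ioi (0 : ℝ))] ψ :=
    (MemLp.toLp_eq_toLp_iff (memLp_testFunction φ) (memLp_testFunction ψ)).1 h
  have h2 : EqOn (φ : ℝ → ℂ) ψ (Ioi 0) :=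
    Measure.eqOn_open_of_ae_eq h1 isOpen_Ioi φ.continuous.continuousOn ψ.continuous.continuousOn
  ext x
  by_cases hx : x ∈ Ioi (0 : ℝ)
  · exact h2 hx
  · rw [image_eq_zero_of_notMem_tsupport (fun h => hx (φ.tsupport_subset h)),
      image_eq_zero_of_notMem_tsupport (fun h => hx (ψ.tsupport_subset h))]

/-- The differential expression `-φ'' + V φ`. -/
def schrodingerExpr (V : ℝ → ℝ) (φ : ℝ → ℂ) (x : ℝ) : ℂ :=
  -deriv (deriv φ) x + (V x : ℂ) * φ x

theorem memLp_schrodingerExpr {V : ℝ → ℝ} (hV : ContinuousOn V (Ioi 0)) (φ : 𝓓(halfLine, ℂ)) :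
    MemLp (schrodingerExpr V φ) 2 (volume.restrict (Ioi (0 : ℝ))) := by
  have hφ : ContDiff ℝ ∞ (φ : ℝ → ℂ) := φ.contDiff
  have hd : Continuous (deriv (deriv (φ : ℝ → ℂ))) := by
    have h := hφ.continuous_iteratedDeriv 2 (WithTop.coe_le_coe.2 le_top)
    simpa [iteratedDeriv_succ, iteratedDeriv_zero] using h
  have hm : Continuous (fun x => (V x : ℂ) * φ x) := by
    rw [continuous_iff_continuousAt]
    intro x
    by_cases hx : x ∈ Ioi (0 : ℝ)
    · exact (Complex.continuous_ofReal.continuousAt.comp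
        (hV.continuousAt (isOpen_Ioi.mem_nhds hx))).mul φ.continuous.continuousAt
    · have h0 : (φ : ℝ → ℂ) =ᶠ[𝓝 x] 0 :=
        notMem_tsupport_iff_eventuallyEq.1 (fun h => hx (φ.tsupport_subset h))
      have h1 : (fun x => (V x : ℂ) * φ x) =ᶠ[𝓝 x] fun _ => 0 := by
        filter_upwards [h0] with y hy
        simp [hy]
      exact continuousAt_const.congr h1.symm
  exact (hd.neg.add hm).memLp_of_hasCompactSupport
    (φ.hasCompactSupport.deriv.deriv.neg.add φ.hasCompactSupport.mul_left)

/-- The map `φ ↦ -φ'' + V φ` from `C_c^∞(0,∞)` to `L²(0,∞)`. -/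
def schrodingerMap (V : ℝ → ℝ) (hV : ContinuousOn V (Ioi 0)) :
    𝓓(halfLine, ℂ) →ₗ[ℂ] L2HalfLine where
  toFun φ := (memLp_schrodingerExpr hV φ).toLp (schrodingerExpr V φ)
  map_add' φ ψ := by
    have hd : ∀ χ : 𝓓(halfLine, ℂ), Differentiable ℝ (χ : ℝ → ℂ) := fun χ =>
      χ.contDiff.differentiable (by simp)
    have hdd : ∀ χ : 𝓓(halfLine, ℂ), Differentiable ℝ (deriv (χ : ℝ → ℂ)) := fun χ =>
      ((χ.contDiff.of_le (WithTop.coe_le_coe.2 le_top)).iterate_deriv' 1 1).differentiable (by simp)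
    rw [← MemLp.toLp_add]
    congr 1
    ext x
    have h1 : deriv (⇑(φ + ψ)) = deriv φ + deriv ψ := by
      ext y; exact deriv_add (hd φ y) (hd ψ y)
    have h2 : deriv (deriv (φ : ℝ → ℂ) + deriv ψ) x = deriv (deriv φ) x + deriv (deriv ψ) x :=
      deriv_add (hdd φ x) (hdd ψ x)
    simp only [schrodingerExpr, Pi.add_apply, h1, h2]
    have h3 : (φ + ψ) x = φ x + ψ x := rfl
    rw [h3]; ring
  map_smul' c φ := by
    rw [RingHom.id_apply, ← MemLp.toLp_const_smul]
    congr 1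
    ext x
    have h1 : deriv (⇑(c • φ)) = c • deriv φ := by
      ext y; exact deriv_const_smul_field c _
    have h2 : deriv (c • deriv (φ : ℝ → ℂ)) x = c * deriv (deriv φ) x :=
      deriv_const_smul_field c _
    simp only [schrodingerExpr, Pi.smul_apply, h1, h2, smul_eq_mul]
    have h3 : (c • φ) x = c * φ x := rfl
    rw [h3]; ring

/-- The operator `-d²/dx² + V` in `L²(0,∞)` with domain `C_c^∞(0,∞)`, for a potential `V` that is
continuous on `(0,∞)`. -/
def schrodingerOp (V : ℝ → ℝ) (hV : ContinuousOn V (Ioi 0)) : L2HalfLine →ₗ.[ℂ] L2HalfLine where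
  domain := LinearMap.range testToL2
  toFun := (schrodingerMap V hV).comp
    (LinearEquiv.ofInjective testToL2 testToL2_injective).symm.toLinearMap

/-! ## Essential self-adjointness, deficiency indices, limit points -/

section Operators

variable {H : Type*} [NormedAddCommGroup H] [InnerProductSpace ℂ H] [CompleteSpace H]

/-- A densely defined closable operator is essentially self-adjoint if its closure is
self-adjoint. -/
def IsEssentiallySelfAdjoint (A : H →ₗ.[ℂ] H) : Prop :=
  Dense (A.domain : Set H) ∧ A.IsClosable ∧ IsSelfAdjoint A.closure

/-- The Horowitz--Marolf criterion: the spatial operator has exactly one self-adjoint extension. -/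
def IsQuantumRegular (A : H →ₗ.[ℂ] H) : Prop :=
  ∃! B : H →ₗ.[ℂ] H, A ≤ B ∧ IsSelfAdjoint B

/-- The deficiency subspace `{ψ ∈ D(A*) | A* ψ = z ψ}`. -/
def deficiencySubspace (A : H →ₗ.[ℂ] H) (z : ℂ) : Submodule ℂ H :=
  Submodule.map A.adjoint.domain.subtype
    (LinearMap.ker (A.adjoint.toFun - z • A.adjoint.domain.subtype))

/-- The dimension of the deficiency subspace. -/
def deficiencyIndex (A : H →ₗ.[ℂ] H) (z : ℂ) : Cardinal :=
  Module.rank ℂ (deficiencySubspace A z)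

end Operators

/-- `ψ` is a (classical) solution of `-ψ'' + V ψ = z ψ` on `(0,∞)`. -/
def IsSolution (V : ℝ → ℝ) (z : ℂ) (ψ : ℝ → ℂ) : Prop :=
  ∃ ψ' ψ'' : ℝ → ℂ, ∀ x > 0, HasDerivAt ψ (ψ' x) x ∧ HasDerivAt ψ' (ψ'' x) x ∧
    -ψ'' x + (V x : ℂ) * ψ x = z * ψ x

/-- Limit circle case at infinity: for some `z` all solutions are square integrable at infinity. -/
def LimitCircleAtInfinity (V : ℝ → ℝ) : Prop :=
  ∃ z : ℂ, ∀ ψ, IsSolution V z ψ → MemLp ψ 2 (volume.restrict (Ioi (1 : ℝ)))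

/-- Limit circle case at zero: for some `z` all solutions are square integrable at zero. -/
def LimitCircleAtZero (V : ℝ → ℝ) : Prop :=
  ∃ z : ℂ, ∀ ψ, IsSolution V z ψ → MemLp ψ 2 (volume.restrict (Ioo (0 : ℝ) 1))

/-- Limit point case at infinity. -/
def LimitPointAtInfinity (V : ℝ → ℝ) : Prop := ¬ LimitCircleAtInfinity V

/-- Limit point case at zero. -/
def LimitPointAtZero (V : ℝ → ℝ) : Prop := ¬ LimitCircleAtZero V

/-! ## The Kehagias--Sfetsos background -/

/-- The metric function: `ds² = -f dt² + dr²/f + r² (dθ² + sin² θ dφ²)`. -/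
def ksF (w M r : ℝ) : ℝ := 1 + w * r ^ 2 - √(r * (w ^ 2 * r ^ 3 + 4 * w * M))

/-- The tortoise coordinate, `d r_* = dr / f`, normalized so that the singularity `r = 0` lies at
`r_* = 0`. -/
def tortoise (w M r : ℝ) : ℝ := ∫ s in (0 : ℝ)..r, 1 / ksF w M s

/-- The radius `r > 0` as a function of the tortoise coordinate `x = r_* > 0`. -/
def radius (w M x : ℝ) : ℝ := Function.invFunOn (tortoise w M) (Ioi 0) x

/-- The potential `f λ² / r² + ε λ d/dr_* (√f / r)` as a function of `x = r_*`; it is `V₊` for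
`ε = 1` and `V₋` for `ε = -1`. -/
def diracPotential (w M lam ε x : ℝ) : ℝ :=
  ksF w M (radius w M x) * lam ^ 2 / radius w M x ^ 2
    + ε * lam * deriv (fun y => √(ksF w M (radius w M y)) / radius w M y) x

/-! ## The massless Chandrasekhar--Dirac equations

Signature `(+,-,-,-)`. The null tetrad of one-forms is `l = dt - dr/f`, `n = (f dt + dr)/2`,
`m = -(r/√2) (dθ + i sin θ dφ)` and the conjugate of `m`. -/

/-- Complex functions of the coordinates `t, r, θ, φ`. -/
abbrev Field4 : Type := ℝ → ℝ → ℝ → ℝ → ℂ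

/-- The derivative `D = l^a ∂_a = f⁻¹ ∂_t + ∂_r`. -/
def npD (f : ℝ → ℝ) (F : Field4) : Field4 := fun t r θ φ =>
  (1 / f r : ℝ) * deriv (fun t' => F t' r θ φ) t + deriv (fun r' => F t r' θ φ) r

/-- The derivative `Δ = n^a ∂_a = (∂_t - f ∂_r) / 2`. -/
def npDelta (f : ℝ → ℝ) (F : Field4) : Field4 := fun t r θ φ =>
  (deriv (fun t' => F t' r θ φ) t - (f r : ℂ) * deriv (fun r' => F t r' θ φ) r) / 2

/-- The derivative `δ = m^a ∂_a = (∂_θ + i (sin θ)⁻¹ ∂_φ) / (√2 r)`. -/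
def npEth (F : Field4) : Field4 := fun t r θ φ =>
  (1 / (√2 * r) : ℝ) * (deriv (fun θ' => F t r θ' φ) θ
    + Complex.I * (1 / Real.sin θ : ℝ) * deriv (fun φ' => F t r θ φ') φ)

/-- The derivative along the conjugate of `m`. -/
def npEthBar (F : Field4) : Field4 := fun t r θ φ =>
  (1 / (√2 * r) : ℝ) * (deriv (fun θ' => F t r θ' φ) θ
    - Complex.I * (1 / Real.sin θ : ℝ) * deriv (fun φ' => F t r θ φ') φ)

/-- Spin coefficient `ρ`. -/
def spinRho (r : ℝ) : ℝ := -1 / r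

/-- Spin coefficient `μ`. -/
def spinMu (f : ℝ → ℝ) (r : ℝ) : ℝ := -f r / (2 * r)

/-- Spin coefficient `γ`. -/
def spinGamma (f : ℝ → ℝ) (r : ℝ) : ℝ := deriv f r / 4

/-- Spin coefficient `β`. -/
def spinBeta (r θ : ℝ) : ℝ := Real.cot θ / (2 * √2 * r)

/-- Spin coefficient `α = -β`. The spin coefficients `ε`, `π`, `τ` of this tetrad vanish and those
that do not vanish are real. -/
def spinAlpha (r θ : ℝ) : ℝ := -spinBeta r θ

/-- The Chandrasekhar--Dirac equations for the spinor components `F₁, F₂, G₁, G₂`. -/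
def CDEquations (f : ℝ → ℝ) (F₁ F₂ G₁ G₂ : Field4) : Prop :=
  ∀ t φ : ℝ, ∀ r > 0, ∀ θ ∈ Ioo 0 Real.pi,
    npD f F₁ t r θ φ - spinRho r * F₁ t r θ φ
      + (npEthBar F₂ t r θ φ - spinAlpha r θ * F₂ t r θ φ) = 0 ∧
    npDelta f F₂ t r θ φ + (spinMu f r - spinGamma f r : ℝ) * F₂ t r θ φ
      + (npEth F₁ t r θ φ + spinBeta r θ * F₁ t r θ φ) = 0 ∧
    npD f G₂ t r θ φ - spinRho r * G₂ t r θ φ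
      - (npEth G₁ t r θ φ - spinAlpha r θ * G₁ t r θ φ) = 0 ∧
    npDelta f G₁ t r θ φ + (spinMu f r - spinGamma f r : ℝ) * G₁ t r θ φ
      - (npEthBar G₂ t r θ φ + spinBeta r θ * G₂ t r θ φ) = 0

/-- A nonzero pair `S₁, S₂` on `(0,π)` of angular functions with azimuthal number `m` and
separation constant `lam`. -/
def IsAngularPair (m lam : ℝ) (S₁ S₂ : ℝ → ℂ) : Prop :=
  (∃ θ ∈ Ioo 0 Real.pi, S₁ θ ≠ 0 ∨ S₂ θ ≠ 0) ∧
  ∀ θ ∈ Ioo 0 Real.pi, DifferentiableAt ℝ S₁ θ ∧ DifferentiableAt ℝ S₂ θ ∧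
    deriv S₁ θ + (Real.cot θ / 2 - m / Real.sin θ : ℝ) * S₁ θ = lam * S₂ θ ∧
    deriv S₂ θ + (Real.cot θ / 2 + m / Real.sin θ : ℝ) * S₂ θ = -lam * S₁ θ

/-- The field `exp(i (k t + m φ)) P(r) S(θ)`. -/
def modeField (k m : ℝ) (P S : ℝ → ℂ) : Field4 := fun t r θ φ =>
  Complex.exp (Complex.I * (k * t + m * φ : ℝ)) * P r * S θ

/-- The separated spinor `F₁ = R₁ S₁ / r`, `F₂ = √2 R₂ S₂ / (r √f)`, `G₁ = √2 R₂ S₁ / (r √f)`,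
`G₂ = R₁ S₂ / r` (times `exp(i (k t + m φ))`) solves the Chandrasekhar--Dirac equations. -/
def IsCDMode (f : ℝ → ℝ) (k m : ℝ) (R₁ R₂ S₁ S₂ : ℝ → ℂ) : Prop :=
  CDEquations f
    (modeField k m (fun r => R₁ r / (r : ℂ)) S₁)
    (modeField k m (fun r => (√2 : ℝ) * R₂ r / (r * √(f r) : ℝ)) S₂)
    (modeField k m (fun r => (√2 : ℝ) * R₂ r / (r * √(f r) : ℝ)) S₁)
    (modeField k m (fun r => R₁ r / (r : ℂ)) S₂)

end KSDirac

end

/-! Write `g = √f / r` for the superpotential, `x = r_*`, and `s = ε λ` with `ε = ±1`. Then `V = s²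
g² + s g'`, so `-d²/dx² + V` factorizes and its zero-energy equation is solved explicitly by `p =
exp (s ∫₁ˣ g)` and, by reduction of order, by `p (1 + c ∫₁ˣ p⁻²)`. The same factorization gives the
reduction. The angular equations remove the angular dependence from the Chandrasekhar–Dirac
equations and leave a first-order system for `R₁, R₂`; differentiating `R₁ + ε R₂` twice produces
`V`.

The estimates use little of the metric: `g > 0`, `dr/dx = f = (g r)²`, `g r ≤ 1` (that is, `f ≤ 1`)
and `r ≤ x`. At infinity `p` stays above a positive constant if `s ≥ 0`, and the second solution
does if `s ≤ 0`. At zero the condition `s² - s ≥ 3/4` means `s ≤ -1/2` or `s ≥ 3/2`. In the first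
case `p² x` is bounded below, in the second `q² x` is for a second solution `q`, and `1/x` is not
integrable at zero. So each endpoint has a zero-energy solution that is not square integrable
(`exists_zeroEnergy_not_memLp_atTop`, `exists_zeroEnergy_not_memLp_zero`).

The passage to other energies is `SolvesOn.exists_integral_le`: if two square integrable solutions,
possibly of different energies, have a Wronskian bounded away from zero near an endpoint, then every
solution of every energy is square integrable there. It is used twice. Applied to a basis with
Wronskian `1`, it excludes the limit circle case. Applied to `ψ` and its conjugate at a non-real
energy `z`, it shows that a square integrable `ψ` vanishes: the imaginary part of their Wronskian is
monotone, with derivative `-2 (Im z) |ψ|²`, so a nonzero value would persist up to one of the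
endpoints.

By the du Bois-Reymond lemma the elements of the deficiency subspaces are classical solutions, so
for non-real `z` these subspaces are trivial. For a densely defined symmetric operator this forces
the closure to equal the adjoint, and a self-adjoint closure is the only self-adjoint extension. -/

open scoped InnerProductSpace

namespace KSDirac

/-! ## Global solutions of linear differential equations -/

section LinearODE

variable {E : Type*} [NormedAddCommGroup E] [NormedSpace ℝ E]

/-- The Picard iterates `u₀ = v`, `uₙ₊₁(t) = ∫₀ᵗ A uₙ` of the linear equation `u' = A u`. -/
noncomputable def picardTerm (A : ℝ → E →L[ℝ] E) (v : E) : ℕ → ℝ → E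
  | 0 => fun _ => v
  | n + 1 => fun t => ∫ s in (0 : ℝ)..t, A s (picardTerm A v n s)

theorem continuous_picardTerm {A : ℝ → E →L[ℝ] E} (hA : Continuous A) (v : E) (n : ℕ) :
    Continuous (picardTerm A v n) := by
  induction n with
  | zero => exact continuous_const
  | succ n ih =>
    exact intervalIntegral.continuous_primitive
      (fun a b => (hA.clm_apply ih).intervalIntegrable a b) 0

/-- Each integration gains a factor `K |t| / (n + 1)`. The factorial decay makes the Picard series
converge on every bounded interval, so the solution is global. -/
theorem norm_picardTerm_le {A : ℝ → E →L[ℝ] E} (v : E) {T K : ℝ}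
    (hK : ∀ t, |t| ≤ T → ‖A t‖ ≤ K) (n : ℕ) :
    ∀ t, |t| ≤ T → ‖picardTerm A v n t‖ ≤ ‖v‖ * ((K * |t|) ^ n / n.factorial) := by
  induction n with
  | zero => intro t _; simp [picardTerm]
  | succ n ih =>
    intro t ht
    have hK0 : 0 ≤ K := (norm_nonneg _).trans (hK t ht)
    have hb : ∀ s, |s| ≤ |t| →
        ‖A s (picardTerm A v n s)‖ ≤ K * (‖v‖ * ((K * |s|) ^ n / n.factorial)) := fun s hs =>
      (ContinuousLinearMap.le_opNorm _ _).trans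
        (mul_le_mul (hK s (hs.trans ht)) (ih s (hs.trans ht)) (norm_nonneg _) hK0)
    have hint : ∀ τ : ℝ, 0 ≤ τ → ∫ s in (0 : ℝ)..τ, K * (‖v‖ * ((K * |s|) ^ n / n.factorial))
        = ‖v‖ * ((K * τ) ^ (n + 1) / (n + 1).factorial) := by
      intro τ hτ
      have h1 : ∫ s in (0 : ℝ)..τ, K * (‖v‖ * ((K * |s|) ^ n / n.factorial))
          = ∫ s in (0 : ℝ)..τ, (K ^ (n + 1) * ‖v‖ / n.factorial) * s ^ n := by
        apply intervalIntegral.integral_congr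
        intro s hs
        rw [uIcc_of_le hτ] at hs
        simp only [abs_of_nonneg hs.1, mul_pow]
        ring
      rw [h1, intervalIntegral.integral_const_mul, integral_pow, Nat.factorial_succ]
      push_cast
      have : (n.factorial : ℝ) ≠ 0 := by positivity
      field_simp
      simp [mul_pow]
      ring
    have hc : Continuous fun s : ℝ => K * (‖v‖ * ((K * |s|) ^ n / n.factorial)) := by fun_prop
    rcases le_total 0 t with h0 | h0
    · rw [abs_of_nonneg h0, ← hint t h0]
      refine intervalIntegral.norm_integral_le_of_norm_le h0 (.of_forall fun s hs => ?_)
        (hc.intervalIntegrable _ _)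
      exact hb s (by rw [abs_of_pos hs.1, abs_of_nonneg h0]; exact hs.2)
    · rw [abs_of_nonpos h0, ← hint (-t) (by linarith)]
      simp only [picardTerm]
      rw [intervalIntegral.integral_symm, norm_neg]
      have h2 : ∫ s in (0 : ℝ)..(-t), K * (‖v‖ * ((K * |s|) ^ n / n.factorial))
          = ∫ s in t..0, K * (‖v‖ * ((K * |s|) ^ n / n.factorial)) := by
        have := intervalIntegral.integral_comp_neg (a := t) (b := 0)
          (fun s : ℝ => K * (‖v‖ * ((K * |s|) ^ n / n.factorial)))
        simp only [abs_neg, neg_zero] at this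
        exact this.symm
      rw [h2]
      refine intervalIntegral.norm_integral_le_of_norm_le h0 (.of_forall fun s hs => ?_)
        (hc.intervalIntegrable _ _)
      exact hb s (by rw [abs_of_nonpos hs.2, abs_of_nonpos h0]; linarith [hs.1])

variable [CompleteSpace E]

theorem hasDerivAt_picardTerm_succ {A : ℝ → E →L[ℝ] E} (hA : Continuous A) (v : E) (n : ℕ)
    (t : ℝ) : HasDerivAt (picardTerm A v (n + 1)) (A t (picardTerm A v n t)) t :=
  intervalIntegral.integral_hasDerivAt_right
    ((hA.clm_apply (continuous_picardTerm hA v n)).intervalIntegrable _ _)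
    ((hA.clm_apply (continuous_picardTerm hA v n)).stronglyMeasurableAtFilter _ _)
    (hA.clm_apply (continuous_picardTerm hA v n)).continuousAt

/-- A linear differential equation with continuous coefficients has global solutions. -/
theorem exists_linearODE_solution {A : ℝ → E →L[ℝ] E} (hA : Continuous A) (v : E) :
    ∃ u : ℝ → E, u 0 = v ∧ ∀ t, HasDerivAt u (A t (u t)) t := by
  have hbound : ∀ T : ℝ, ∃ K, ∀ t, |t| ≤ T → ‖A t‖ ≤ K := fun T => by
    obtain ⟨K, hK⟩ := (isCompact_Icc (a := -T) (b := T)).exists_bound_of_continuousOn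
      hA.continuousOn
    exact ⟨K, fun t ht => hK t (abs_le.1 ht)⟩
  have hsum : ∀ t, Summable fun n => picardTerm A v n t := fun t => by
    obtain ⟨K, hK⟩ := hbound |t|
    exact Summable.of_norm_bounded ((Real.summable_pow_div_factorial (K * |t|)).mul_left ‖v‖)
      fun n => norm_picardTerm_le v hK n t le_rfl
  refine ⟨fun t => ∑' n, picardTerm A v n t, ?_, fun t => ?_⟩
  · refine (tsum_eq_single 0 ?_).trans rfl
    · intro n hn
      obtain ⟨n, rfl⟩ := Nat.exists_eq_succ_of_ne_zero hn
      simp [picardTerm]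
  · obtain ⟨K, hK⟩ := hbound (|t| + 1)
    have hK0 : 0 ≤ K := (norm_nonneg _).trans (hK t (by linarith))
    have hbd : ∀ n : ℕ, ∀ y ∈ Metric.ball (0 : ℝ) (|t| + 1), ‖A y (picardTerm A v n y)‖ ≤
        K * (‖v‖ * ((K * (|t| + 1)) ^ n / n.factorial)) := fun n y hy => by
      have hy' : |y| ≤ |t| + 1 := by
        rw [mem_ball_zero_iff, Real.norm_eq_abs] at hy; exact hy.le
      refine (ContinuousLinearMap.le_opNorm _ _).trans
        (mul_le_mul (hK y hy') ((norm_picardTerm_le v hK n y hy').trans ?_)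
          (norm_nonneg _) hK0)
      gcongr
    -- Termwise differentiation on a ball around `0` of radius `|t| + 1`, which contains `t` in its
    -- interior; there the derivatives are dominated by a summable sequence. The series starts at
    -- index `1` because the zeroth term is constant.
    have hder : HasDerivAt (fun s => ∑' n, picardTerm A v (n + 1) s)
        (∑' n, A t (picardTerm A v n t)) t :=
      hasDerivAt_tsum_of_isPreconnected (t := Metric.ball 0 (|t| + 1)) (y₀ := 0)
        (g := fun n s => picardTerm A v (n + 1) s) (g' := fun n s => A s (picardTerm A v n s))
        (((Real.summable_pow_div_factorial (K * (|t| + 1))).mul_left ‖v‖).mul_left K)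
        Metric.isOpen_ball (convex_ball _ _).isPreconnected
        (fun n y _ => hasDerivAt_picardTerm_succ hA v n y) hbd
        (Metric.mem_ball_self (by positivity)) ((summable_nat_add_iff 1).2 (hsum 0))
        (by simp [Metric.mem_ball])
    have heq : (fun s => ∑' n, picardTerm A v n s) =
        fun s => v + ∑' n, picardTerm A v (n + 1) s := by
      ext s
      rw [(hsum s).tsum_eq_zero_add]
      rfl
    have h3 : A t (∑' n, picardTerm A v n t) = ∑' n, A t (picardTerm A v n t) :=
      (A t).map_tsum (hsum t)
    rw [h3, heq]
    exact hder.const_add v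

end LinearODE

/-- The initial value problem at `x = 1` for `-ψ'' + V ψ = z ψ` on the half-line is solvable. -/
theorem exists_solution {V : ℝ → ℝ} (hV : ContinuousOn V (Ioi 0)) (z a b : ℂ) :
    ∃ ψ ψ' : ℝ → ℂ, ψ 1 = a ∧ ψ' 1 = b ∧ ∀ x > 0, HasDerivAt ψ (ψ' x) x ∧
      HasDerivAt ψ' ((V x - z) * ψ x) x := by
  -- The substitution `x = exp y` turns the half-line into the whole line and the base point `x = 1`
  -- into `y = 0`, so `V` may be arbitrarily singular at `x = 0`. The factors `exp y` in `A` come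
  -- from the chain rule.
  have hVe : Continuous fun y => V (Real.exp y) :=
    hV.comp_continuous Real.continuous_exp fun y => Real.exp_pos y
  let A : ℝ → (ℂ × ℂ) →L[ℝ] (ℂ × ℂ) := fun y =>
    Real.exp y • ((ContinuousLinearMap.inl ℝ ℂ ℂ).comp (ContinuousLinearMap.snd ℝ ℂ ℂ)) +
    (Real.exp y * V (Real.exp y)) •
      ((ContinuousLinearMap.inr ℝ ℂ ℂ).comp (ContinuousLinearMap.fst ℝ ℂ ℂ)) -
    Real.exp y • ((ContinuousLinearMap.inr ℝ ℂ ℂ).comp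
      ((ContinuousLinearMap.mul ℝ ℂ z).comp (ContinuousLinearMap.fst ℝ ℂ ℂ)))
  have hA : Continuous A :=
    ((Real.continuous_exp.smul continuous_const).add
      ((Real.continuous_exp.mul hVe).smul continuous_const)).sub
      (Real.continuous_exp.smul continuous_const)
  obtain ⟨u, hu0, hu⟩ := exists_linearODE_solution hA (a, b)
  refine ⟨fun x => (u (Real.log x)).1, fun x => (u (Real.log x)).2, by simp [hu0], by simp [hu0],
    fun x hx => ?_⟩
  have h := (hu (Real.log x)).scomp x (Real.hasDerivAt_log hx.ne')
  have hx0 : (x : ℂ) ≠ 0 := by exact_mod_cast hx.ne'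
  constructor
  · convert! (ContinuousLinearMap.fst ℝ ℂ ℂ).hasFDerivAt.comp_hasDerivAt x h using 1
    simp [A, Real.exp_log hx, hx0]
  · convert! (ContinuousLinearMap.snd ℝ ℂ ℂ).hasFDerivAt.comp_hasDerivAt x h using 1
    simp [A, Real.exp_log hx]
    field_simp

/-! ## Weyl's limit point argument -/

/-- `ψ` solves `-ψ'' + V ψ = z ψ` at the points of `S`, and `ψ'` is its derivative there. -/
def SolvesOn (V : ℝ → ℝ) (z : ℂ) (ψ ψ' : ℝ → ℂ) (S : Set ℝ) : Prop :=
  ∀ x ∈ S, HasDerivAt ψ (ψ' x) x ∧ HasDerivAt ψ' ((V x - z) * ψ x) x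

/-- The Wronskian `ψ' χ - ψ χ'`. -/
def wronskian (ψ ψ' χ χ' : ℝ → ℂ) (x : ℝ) : ℂ := ψ' x * χ x - ψ x * χ' x

section

variable {V : ℝ → ℝ} {z z₀ z₁ z₂ : ℂ} {ψ ψ' χ χ' q q' ψ₁ ψ₁' ψ₂ ψ₂' : ℝ → ℂ} {S T : Set ℝ}

theorem SolvesOn.mono (h : SolvesOn V z ψ ψ' S) (hT : T ⊆ S) : SolvesOn V z ψ ψ' T :=
  fun x hx => h x (hT hx)

theorem SolvesOn.continuousOn (h : SolvesOn V z ψ ψ' S) : ContinuousOn ψ S :=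
  fun x hx => (h x hx).1.continuousAt.continuousWithinAt

theorem SolvesOn.isSolution (h : SolvesOn V z ψ ψ' (Ioi 0)) : IsSolution V z ψ :=
  ⟨ψ', fun x => (V x - z) * ψ x, fun x hx => ⟨(h x hx).1, (h x hx).2, by ring⟩⟩

/-- Reflection exchanges left and right endpoints, so the integral estimate below is needed for
right endpoints only. -/
theorem SolvesOn.comp_neg (h : SolvesOn V z ψ ψ' S) :
    SolvesOn (fun x => V (-x)) z (fun x => ψ (-x)) (fun x => -ψ' (-x)) (Neg.neg ⁻¹' S) := by
  intro x hx
  obtain ⟨h1, h2⟩ := h (-x) hx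
  constructor
  · simpa [Function.comp_def] using h1.scomp x (hasDerivAt_neg x)
  · convert! (h2.scomp x (hasDerivAt_neg x)).neg using 1
    simp

theorem SolvesOn.conj (h : SolvesOn V z ψ ψ' S) :
    SolvesOn V (starRingEnd ℂ z) (fun x => starRingEnd ℂ (ψ x))
      (fun x => starRingEnd ℂ (ψ' x)) S := by
  intro x hx
  obtain ⟨h1, h2⟩ := h x hx
  exact ⟨h1.star, by simpa using h2.star⟩

/-- The potential is common to both solutions and cancels; only the difference of the energies
survives. -/
theorem SolvesOn.hasDerivAt_wronskian (hψ : SolvesOn V z₁ ψ ψ' S) (hχ : SolvesOn V z₂ χ χ' S)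
    {x : ℝ} (hx : x ∈ S) :
    HasDerivAt (wronskian ψ ψ' χ χ') ((z₂ - z₁) * (ψ x * χ x)) x := by
  obtain ⟨h1, h2⟩ := hψ x hx
  obtain ⟨h3, h4⟩ := hχ x hx
  convert! (h2.mul h3).sub (h1.mul h4) using 1
  ring

/-- Growth of the Wronskian of a square integrable solution with a reference solution `q`. -/
theorem SolvesOn.norm_wronskian_le {b x B : ℝ} (hbx : b ≤ x) (hψ : SolvesOn V z ψ ψ' (Icc b x))
    (hq : SolvesOn V z₀ q q' (Icc b x)) (hB : ∫ t in b..x, ‖ψ t‖ ^ 2 ≤ B) :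
    ‖wronskian ψ ψ' q q' x‖ ≤
      √(1 + ∫ t in b..x, ‖q t‖ ^ 2) * (‖wronskian ψ ψ' q q' b‖ + ‖z₀ - z‖ * ((1 + B) / 2)) := by
  set Q := 1 + ∫ t in b..x, ‖q t‖ ^ 2 with hQ
  have hI : 0 ≤ ∫ t in b..x, ‖q t‖ ^ 2 :=
    intervalIntegral.integral_nonneg hbx fun t _ => by positivity
  have hR1 : 1 ≤ √Q := Real.one_le_sqrt.2 (by linarith)
  have hR0 : 0 < √Q := by linarith
  have hRQ : √Q * √Q = Q := Real.mul_self_sqrt (by linarith)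
  have hcψ : ContinuousOn ψ (uIcc b x) := by rw [uIcc_of_le hbx]; exact hψ.continuousOn
  have hcq : ContinuousOn q (uIcc b x) := by rw [uIcc_of_le hbx]; exact hq.continuousOn
  have hiψ : IntervalIntegrable (fun t => ‖ψ t‖ ^ 2) volume b x :=
    (hcψ.norm.pow 2).intervalIntegrable
  have hiq : IntervalIntegrable (fun t => ‖q t‖ ^ 2) volume b x :=
    (hcq.norm.pow 2).intervalIntegrable
  have hftc : ∫ t in b..x, (z₀ - z) * (ψ t * q t) =
      wronskian ψ ψ' q q' x - wronskian ψ ψ' q q' b :=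
    intervalIntegral.integral_eq_sub_of_hasDerivAt
      (fun t ht => hψ.hasDerivAt_wronskian hq (by rwa [uIcc_of_le hbx] at ht))
      (continuousOn_const.mul (hcψ.mul hcq)).intervalIntegrable
  have hbound : ‖∫ t in b..x, (z₀ - z) * (ψ t * q t)‖ ≤
      ∫ t in b..x, ‖z₀ - z‖ * ((‖q t‖ ^ 2 / √Q + √Q * ‖ψ t‖ ^ 2) / 2) := by
    refine intervalIntegral.norm_integral_le_of_norm_le hbx (.of_forall fun t _ => ?_)
      ((((hiq.div_const _).add (hiψ.const_mul _)).div_const _).const_mul _)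
    rw [norm_mul, norm_mul]
    refine mul_le_mul_of_nonneg_left ?_ (norm_nonneg _)
    -- Weighted arithmetic-geometric mean inequality. With the weight `√Q`, fixed at the endpoint
    -- `x`, both terms integrate to `O(√Q)`; the `1` in `Q` makes `√Q ≥ 1`, which also absorbs the
    -- boundary value at `b`.
    have h : 0 ≤ (‖q t‖ - √Q * ‖ψ t‖) ^ 2 / √Q := by positivity
    have h2 : (‖q t‖ - √Q * ‖ψ t‖) ^ 2 / √Q =
        ‖q t‖ ^ 2 / √Q + √Q * ‖ψ t‖ ^ 2 - 2 * (‖ψ t‖ * ‖q t‖) := by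
      field_simp; ring
    linarith
  have heval : ∫ t in b..x, ‖z₀ - z‖ * ((‖q t‖ ^ 2 / √Q + √Q * ‖ψ t‖ ^ 2) / 2) =
      ‖z₀ - z‖ * (((Q - 1) / √Q + √Q * ∫ t in b..x, ‖ψ t‖ ^ 2) / 2) := by
    rw [intervalIntegral.integral_const_mul, intervalIntegral.integral_div,
      intervalIntegral.integral_add (hiq.div_const _) (hiψ.const_mul _),
      intervalIntegral.integral_div, intervalIntegral.integral_const_mul, hQ]
    ring
  have h1 : (Q - 1) / √Q ≤ √Q := by
    rw [div_le_iff₀ hR0]; linarith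
  have h2 : ‖z₀ - z‖ * (((Q - 1) / √Q + √Q * ∫ t in b..x, ‖ψ t‖ ^ 2) / 2) ≤
      ‖z₀ - z‖ * ((√Q + √Q * B) / 2) := by gcongr
  have h3 : ‖wronskian ψ ψ' q q' x‖ ≤ ‖wronskian ψ ψ' q q' b‖ +
      ‖wronskian ψ ψ' q q' x - wronskian ψ ψ' q q' b‖ := by
    simpa using norm_add_le (wronskian ψ ψ' q q' b)
      (wronskian ψ ψ' q q' x - wronskian ψ ψ' q q' b)
  rw [← hftc] at h3
  have h4 : ‖wronskian ψ ψ' q q' b‖ ≤ √Q * ‖wronskian ψ ψ' q q' b‖ :=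
    le_mul_of_one_le_left (norm_nonneg _) hR1
  calc _ ≤ _ := h3
    _ ≤ √Q * ‖wronskian ψ ψ' q q' b‖ + ‖z₀ - z‖ * ((√Q + √Q * B) / 2) := by linarith
    _ = _ := by ring

/-- If the Wronskian of two square integrable solutions (of possibly different energies) stays away
from zero then every solution of every energy is square integrable. -/
theorem SolvesOn.exists_integral_le {b B c : ℝ} (hS : ∀ x ∈ S, b ≤ x ∧ Icc b x ⊆ S)
    (hq : SolvesOn V z₀ q q' S) (h₁ : SolvesOn V z₁ ψ₁ ψ₁' S) (h₂ : SolvesOn V z₂ ψ₂ ψ₂' S)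
    (hB₁ : ∀ x ∈ S, ∫ t in b..x, ‖ψ₁ t‖ ^ 2 ≤ B) (hB₂ : ∀ x ∈ S, ∫ t in b..x, ‖ψ₂ t‖ ^ 2 ≤ B)
    (hc : 0 < c) (hw : ∀ x ∈ S, c ≤ ‖wronskian ψ₁ ψ₁' ψ₂ ψ₂' x‖) :
    ∃ K, ∀ x ∈ S, ∫ t in b..x, ‖q t‖ ^ 2 ≤ K := by
  set D₁ := ‖wronskian ψ₁ ψ₁' q q' b‖ + ‖z₀ - z₁‖ * ((1 + B) / 2) with hD₁
  set D₂ := ‖wronskian ψ₂ ψ₂' q q' b‖ + ‖z₀ - z₂‖ * ((1 + B) / 2) with hD₂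
  set C := 2 * (D₁ ^ 2 + D₂ ^ 2) / c ^ 2 with hC
  have hC0 : 0 ≤ C := by positivity
  refine ⟨Real.exp (C * (B + B)), fun x hx => ?_⟩
  obtain ⟨hbx, hsub⟩ := hS x hx
  have hS' : ∀ t ∈ Icc b x, b ≤ t ∧ Icc b t ⊆ Icc b x := fun t ht =>
    ⟨ht.1, Icc_subset_Icc_right ht.2⟩
  have hcq : ContinuousOn (fun t => ‖q t‖ ^ 2) (Icc b x) := ((hq.mono hsub).continuousOn.norm.pow 2)
  have hc1 : ContinuousOn (fun t => ‖ψ₁ t‖ ^ 2) (Icc b x) :=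
    ((h₁.mono hsub).continuousOn.norm.pow 2)
  have hc2 : ContinuousOn (fun t => ‖ψ₂ t‖ ^ 2) (Icc b x) :=
    ((h₂.mono hsub).continuousOn.norm.pow 2)
  have hii : ∀ {f : ℝ → ℝ}, ContinuousOn f (Icc b x) → IntervalIntegrable f volume b x :=
    fun hf => ContinuousOn.intervalIntegrable (by rwa [uIcc_of_le hbx])
  set Q : ℝ → ℝ := fun t => 1 + ∫ s in b..t, ‖q s‖ ^ 2 with hQ
  have hQ1 : ∀ t, b ≤ t → 1 ≤ Q t := fun t ht => by
    have := intervalIntegral.integral_nonneg (f := fun s => ‖q s‖ ^ 2) (μ := volume) ht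
      fun t _ => by positivity
    simp only [hQ]; linarith
  have hQd : ∀ t ∈ Ioo b x, HasDerivAt Q (‖q t‖ ^ 2) t := fun t ht => by
    refine (intervalIntegral.integral_hasDerivAt_right ?_ ?_ ?_).const_add 1
    · exact ((hcq.mono (by
        rw [uIcc_of_le ht.1.le]
        exact Icc_subset_Icc_right ht.2.le))).intervalIntegrable
    · exact (hcq.mono Ioo_subset_Icc_self).stronglyMeasurableAtFilter isOpen_Ioo t ht
    · exact hcq.continuousAt (Icc_mem_nhds ht.1 ht.2)
  have hQc : ContinuousOn Q (Icc b x) := by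
    refine continuousOn_const.add ?_
    have := intervalIntegral.continuousOn_primitive_interval
      (f := fun s => ‖q s‖ ^ 2) (a := b) (b := x) (μ := volume)
      (by rw [uIcc_of_le hbx]; exact hcq.integrableOn_Icc)
    rwa [uIcc_of_le hbx] at this
  have hpt : ∀ t ∈ Icc b x, ‖q t‖ ^ 2 / Q t ≤ C * (‖ψ₁ t‖ ^ 2 + ‖ψ₂ t‖ ^ 2) := fun t ht => by
    have htS := hsub ht
    have hQt := hQ1 t ht.1
    have e1 := (h₁.mono (hS t htS).2).norm_wronskian_le ht.1 (hq.mono (hS t htS).2) (hB₁ t htS)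
    have e2 := (h₂.mono (hS t htS).2).norm_wronskian_le ht.1 (hq.mono (hS t htS).2) (hB₂ t htS)
    change _ ≤ √(Q t) * D₁ at e1
    change _ ≤ √(Q t) * D₂ at e2
    -- This algebraic identity recovers `q` from its Wronskians with `ψ₁` and `ψ₂`, which are
    -- `O(√Q)`; hence `‖q‖² / Q` is dominated by an integrable function.
    have hid : q t * wronskian ψ₁ ψ₁' ψ₂ ψ₂' t =
        wronskian ψ₁ ψ₁' q q' t * ψ₂ t - ψ₁ t * wronskian ψ₂ ψ₂' q q' t := by
      simp only [wronskian]; ring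
    have hn : c * ‖q t‖ ≤ √(Q t) * (D₁ * ‖ψ₂ t‖ + D₂ * ‖ψ₁ t‖) := by
      calc c * ‖q t‖ ≤ ‖wronskian ψ₁ ψ₁' ψ₂ ψ₂' t‖ * ‖q t‖ := by gcongr; exact hw t htS
        _ = ‖wronskian ψ₁ ψ₁' q q' t * ψ₂ t - ψ₁ t * wronskian ψ₂ ψ₂' q q' t‖ := by
          rw [← hid, norm_mul, mul_comm]
        _ ≤ ‖wronskian ψ₁ ψ₁' q q' t‖ * ‖ψ₂ t‖ + ‖ψ₁ t‖ * ‖wronskian ψ₂ ψ₂' q q' t‖ := by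
          rw [← norm_mul, ← norm_mul]; exact norm_sub_le _ _
        _ ≤ (√(Q t) * D₁) * ‖ψ₂ t‖ + ‖ψ₁ t‖ * (√(Q t) * D₂) := by gcongr
        _ = _ := by ring
    have hsq : (c * ‖q t‖) ^ 2 ≤ (√(Q t) * (D₁ * ‖ψ₂ t‖ + D₂ * ‖ψ₁ t‖)) ^ 2 := by gcongr
    rw [mul_pow, mul_pow, Real.sq_sqrt (by linarith)] at hsq
    have hcs : (D₁ * ‖ψ₂ t‖ + D₂ * ‖ψ₁ t‖) ^ 2 ≤
        2 * (D₁ ^ 2 + D₂ ^ 2) * (‖ψ₁ t‖ ^ 2 + ‖ψ₂ t‖ ^ 2) := by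
      nlinarith [sq_nonneg (D₁ * ‖ψ₂ t‖ - D₂ * ‖ψ₁ t‖), sq_nonneg (D₁ * ‖ψ₁ t‖),
        sq_nonneg (D₂ * ‖ψ₂ t‖)]
    rw [div_le_iff₀ (by linarith), hC, div_mul_eq_mul_div, div_mul_eq_mul_div,
      le_div_iff₀ (by positivity)]
    calc ‖q t‖ ^ 2 * c ^ 2 = c ^ 2 * ‖q t‖ ^ 2 := mul_comm _ _
      _ ≤ _ := hsq
      _ ≤ Q t * (2 * (D₁ ^ 2 + D₂ ^ 2) * (‖ψ₁ t‖ ^ 2 + ‖ψ₂ t‖ ^ 2)) := by gcongr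
      _ = _ := mul_comm _ _
  have hne : ∀ t ∈ Icc b x, Q t ≠ 0 := fun t ht => by linarith [hQ1 t ht.1]
  have hcdiv : ContinuousOn (fun t => ‖q t‖ ^ 2 / Q t) (Icc b x) := hcq.div hQc hne
  -- Since `Q' = ‖q‖²`, the pointwise bound controls the logarithmic derivative of `Q`. So `log Q`
  -- stays bounded, uniformly in `x`.
  have hlog : ∫ t in b..x, ‖q t‖ ^ 2 / Q t = Real.log (Q x) - Real.log (Q b) :=
    intervalIntegral.integral_eq_sub_of_hasDerivAt_of_le hbx (hQc.log hne)
      (fun t ht => (hQd t ht).log (hne t (Ioo_subset_Icc_self ht))) (hii hcdiv)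
  have hQb : Q b = 1 := by simp [hQ]
  have hle : ∫ t in b..x, ‖q t‖ ^ 2 / Q t ≤ C * (B + B) := by
    calc _ ≤ ∫ t in b..x, C * (‖ψ₁ t‖ ^ 2 + ‖ψ₂ t‖ ^ 2) :=
          intervalIntegral.integral_mono_on hbx (hii hcdiv)
            (((hii hc1).add (hii hc2)).const_mul C) hpt
      _ = C * ((∫ t in b..x, ‖ψ₁ t‖ ^ 2) + ∫ t in b..x, ‖ψ₂ t‖ ^ 2) := by
        rw [intervalIntegral.integral_const_mul, intervalIntegral.integral_add (hii hc1) (hii hc2)]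
      _ ≤ _ := by gcongr; exacts [hB₁ x hx, hB₂ x hx]
  rw [hlog, hQb, Real.log_one, sub_zero, Real.log_le_iff_le_exp (by linarith [hQ1 x hbx])] at hle
  simp only [hQ] at hle
  linarith

/-! ### The Wronskian criterion at the two endpoints. -/

theorem integrable_norm_sq_iff_memLp {f : ℝ → ℂ} {s : Set ℝ} (hs : MeasurableSet s)
    (hf : ContinuousOn f s) :
    MemLp f 2 (volume.restrict s) ↔ IntegrableOn (fun x => ‖f x‖ ^ 2) s := by
  rw [memLp_two_iff_integrable_sq_norm (hf.aestronglyMeasurable hs)]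
  rfl

/-- Contrapositive of the integral estimate on `[b, ∞)`. The energies `z₀, z₁, z₂` are independent,
so one bad solution at zero energy constrains every other energy. -/
theorem SolvesOn.not_wronskian_bounded_below_atTop {b c : ℝ} (hb : 1 ≤ b) (hc : 0 < c)
    (hq : SolvesOn V z₀ q q' (Ioi 0)) (h₁ : SolvesOn V z₁ ψ₁ ψ₁' (Ioi 0))
    (h₂ : SolvesOn V z₂ ψ₂ ψ₂' (Ioi 0)) (hq2 : ¬ MemLp q 2 (volume.restrict (Ioi 1)))
    (hm₁ : MemLp ψ₁ 2 (volume.restrict (Ioi 1))) (hm₂ : MemLp ψ₂ 2 (volume.restrict (Ioi 1))) :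
    ¬ ∀ x ≥ b, c ≤ ‖wronskian ψ₁ ψ₁' ψ₂ ψ₂' x‖ := by
  intro hw
  have h01 : Ioi (1 : ℝ) ⊆ Ioi 0 := Ioi_subset_Ioi zero_le_one
  have hsub : Ici b ⊆ Ioi 0 := fun x hx => lt_of_lt_of_le (by linarith) (mem_Ici.1 hx)
  rw [integrable_norm_sq_iff_memLp measurableSet_Ioi (h₁.continuousOn.mono h01)] at hm₁
  rw [integrable_norm_sq_iff_memLp measurableSet_Ioi (h₂.continuousOn.mono h01)] at hm₂
  have hbd : ∀ {f : ℝ → ℝ}, (∀ t, 0 ≤ f t) → IntegrableOn f (Ioi 1) → ∀ x ∈ Ici b,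
      ∫ t in b..x, f t ≤ ∫ t in Ioi (1 : ℝ), f t := fun {f} hf0 hf x hx => by
    rw [intervalIntegral.integral_of_le hx]
    exact setIntegral_mono_set hf (.of_forall hf0)
      (.of_forall fun t ht => lt_of_le_of_lt hb ht.1)
  obtain ⟨K, hK⟩ := SolvesOn.exists_integral_le (S := Ici b)
    (B := (∫ t in Ioi (1 : ℝ), ‖ψ₁ t‖ ^ 2) + ∫ t in Ioi (1 : ℝ), ‖ψ₂ t‖ ^ 2)
    (fun x hx => ⟨hx, Icc_subset_Ici_self⟩) (hq.mono hsub) (h₁.mono hsub) (h₂.mono hsub)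
    (fun x hx => (hbd (fun t => by positivity) hm₁ x hx).trans
      (le_add_of_nonneg_right (integral_nonneg fun t => by positivity)))
    (fun x hx => (hbd (fun t => by positivity) hm₂ x hx).trans
      (le_add_of_nonneg_left (integral_nonneg fun t => by positivity))) hc (fun x hx => hw x hx)
  apply hq2
  rw [integrable_norm_sq_iff_memLp measurableSet_Ioi (hq.continuousOn.mono h01),
    ← Ioc_union_Ioi_eq_Ioi hb]
  have hcq : ContinuousOn (fun x => ‖q x‖ ^ 2) (Ioi 0) := hq.continuousOn.norm.pow 2
  refine IntegrableOn.union ?_ ?_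
  · exact ((hcq.mono (fun x hx => lt_of_lt_of_le one_pos hx.1)).integrableOn_Icc).mono_set
      Ioc_subset_Icc_self
  · refine integrableOn_Ioi_of_intervalIntegral_norm_bounded K b (b := fun x : ℝ => x) (l := atTop)
      (fun x => ?_) tendsto_id ?_
    · exact ((hcq.mono (fun t ht => lt_of_lt_of_le (by linarith) ht.1)).integrableOn_Icc).mono_set
        Ioc_subset_Icc_self
    · filter_upwards [eventually_ge_atTop b] with x hx
      simpa using hK x hx

/-- The counterpart at zero, obtained by reflecting `(0, b]` to `[-b, 0)`. -/
theorem SolvesOn.not_wronskian_bounded_below_zero {b c : ℝ} (hb0 : 0 < b) (hb : b ≤ 1) (hc : 0 < c)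
    (hq : SolvesOn V z₀ q q' (Ioi 0)) (h₁ : SolvesOn V z₁ ψ₁ ψ₁' (Ioi 0))
    (h₂ : SolvesOn V z₂ ψ₂ ψ₂' (Ioi 0)) (hq2 : ¬ MemLp q 2 (volume.restrict (Ioo 0 1)))
    (hm₁ : MemLp ψ₁ 2 (volume.restrict (Ioo 0 1))) (hm₂ : MemLp ψ₂ 2 (volume.restrict (Ioo 0 1))) :
    ¬ ∀ x, 0 < x → x ≤ b → c ≤ ‖wronskian ψ₁ ψ₁' ψ₂ ψ₂' x‖ := by
  intro hw
  have h01 : Ioo (0 : ℝ) 1 ⊆ Ioi 0 := Ioo_subset_Ioi_self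
  have hsub : Ico (-b) 0 ⊆ Neg.neg ⁻¹' Ioi (0 : ℝ) := fun x hx => by
    simpa using hx.2
  rw [integrable_norm_sq_iff_memLp measurableSet_Ioo (h₁.continuousOn.mono h01)] at hm₁
  rw [integrable_norm_sq_iff_memLp measurableSet_Ioo (h₂.continuousOn.mono h01)] at hm₂
  have hcv : ∀ (f : ℝ → ℝ) (x : ℝ), ∫ t in (-b)..x, f (-t) = ∫ t in (-x)..b, f t := fun f x => by
    rw [intervalIntegral.integral_comp_neg f, neg_neg]
  have hbd : ∀ {f : ℝ → ℝ}, (∀ t, 0 ≤ f t) → IntegrableOn f (Ioo 0 1) → ∀ x ∈ Ico (-b) 0,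
      ∫ t in (-b)..x, f (-t) ≤ ∫ t in Ioo (0 : ℝ) 1, f t := fun {f} hf0 hf x hx => by
    rw [hcv, intervalIntegral.integral_of_le (by linarith [hx.1]), ← integral_Ioc_eq_integral_Ioo]
    rw [← integrableOn_Ioc_iff_integrableOn_Ioo] at hf
    exact setIntegral_mono_set hf (.of_forall hf0)
      (.of_forall fun t ht => ⟨by linarith [ht.1, hx.2], ht.2.trans hb⟩)
  obtain ⟨K, hK⟩ := SolvesOn.exists_integral_le (S := Ico (-b) 0) (b := -b)
    (B := (∫ t in Ioo (0 : ℝ) 1, ‖ψ₁ t‖ ^ 2) + ∫ t in Ioo (0 : ℝ) 1, ‖ψ₂ t‖ ^ 2)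
    (fun x hx => ⟨hx.1, fun t ht => ⟨ht.1, lt_of_le_of_lt ht.2 hx.2⟩⟩)
    (hq.comp_neg.mono hsub) (h₁.comp_neg.mono hsub) (h₂.comp_neg.mono hsub)
    (fun x hx => (hbd (f := fun t => ‖ψ₁ t‖ ^ 2) (fun t => by positivity) hm₁ x hx).trans
      (le_add_of_nonneg_right (integral_nonneg fun t => by positivity)))
    (fun x hx => (hbd (f := fun t => ‖ψ₂ t‖ ^ 2) (fun t => by positivity) hm₂ x hx).trans
      (le_add_of_nonneg_left (integral_nonneg fun t => by positivity))) hc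
    (fun x hx => by
      -- Reflection changes the sign of the Wronskian but not its norm.
      have := hw (-x) (by linarith [hx.2]) (by linarith [hx.1])
      rw [← norm_neg] at this
      convert this using 1
      simp only [wronskian]
      congr 1
      ring)
  apply hq2
  have hcq : ContinuousOn (fun x => ‖q x‖ ^ 2) (Ioi 0) := hq.continuousOn.norm.pow 2
  rw [integrable_norm_sq_iff_memLp measurableSet_Ioo (hq.continuousOn.mono h01),
    ← integrableOn_Ioc_iff_integrableOn_Ioo, ← Ioc_union_Ioc_eq_Ioc hb0.le hb]
  refine IntegrableOn.union ?_ ?_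
  · have ha0 : ∀ n : ℕ, 0 < b * (1 / ((n : ℝ) + 1)) := fun n => by positivity
    refine integrableOn_Ioc_of_intervalIntegral_norm_bounded_left (I := K)
      (a := fun n : ℕ => b * (1 / ((n : ℝ) + 1))) (l := atTop) (fun n => ?_)
      (by simpa using tendsto_one_div_add_atTop_nhds_zero_nat.const_mul b) (.of_forall fun n => ?_)
    · exact ((hcq.mono (fun x hx => lt_of_lt_of_le (ha0 n) hx.1)).integrableOn_Icc).mono_set
        Ioc_subset_Icc_self
    · have hn : b * (1 / ((n : ℝ) + 1)) ≤ b := by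
        refine mul_le_of_le_one_right hb0.le ((div_le_one (by positivity)).2 ?_)
        have : (0 : ℝ) ≤ n := n.cast_nonneg
        linarith
      have := hK (-(b * (1 / ((n : ℝ) + 1)))) ⟨by linarith, by linarith [ha0 n]⟩
      rw [hcv (fun t => ‖q t‖ ^ 2), neg_neg, intervalIntegral.integral_of_le hn] at this
      simpa using this
  · exact ((hcq.mono (fun x hx => lt_of_lt_of_le hb0 hx.1)).integrableOn_Icc).mono_set
      Ioc_subset_Icc_self

end

/-! ## The Kehagias--Sfetsos metric function and the tortoise coordinate -/

section Background

variable {w M : ℝ}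

theorem ksF_radicand_pos (hw : 0 < w) (hM : 0 < M) {r : ℝ} (hr : 0 < r) :
    0 < r * (w ^ 2 * r ^ 3 + 4 * w * M) := by positivity

theorem continuous_ksF : Continuous (ksF w M) := by
  unfold ksF; fun_prop

theorem ksF_pos (hw : 0 < w) (hnaked : w * M ^ 2 < 1 / 2) (r : ℝ) :
    0 < ksF w M r := by
  unfold ksF
  rw [sub_pos, Real.sqrt_lt' (by positivity)]
  -- After squaring, the claim is `2 w (r - M)² + (1 - 2 w M²) > 0`; this is where the absence of a
  -- horizon uses `w M² < 1/2`.
  nlinarith [sq_nonneg (r - M)]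

theorem ksF_le_one (hw : 0 < w) (hM : 0 < M) {r : ℝ} (hr : 0 ≤ r) : ksF w M r ≤ 1 := by
  unfold ksF
  have : w * r ^ 2 ≤ √(r * (w ^ 2 * r ^ 3 + 4 * w * M)) := by
    apply Real.le_sqrt_of_sq_le
    have : 0 ≤ r * (4 * w * M) := by positivity
    nlinarith
  linarith

/-- The derivative of the metric function. -/
noncomputable def ksFDeriv (w M r : ℝ) : ℝ :=
  2 * w * r - (4 * w ^ 2 * r ^ 3 + 4 * w * M) / (2 * √(r * (w ^ 2 * r ^ 3 + 4 * w * M)))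

theorem hasDerivAt_ksF (hw : 0 < w) (hM : 0 < M) {r : ℝ} (hr : 0 < r) :
    HasDerivAt (ksF w M) (ksFDeriv w M r) r := by
  have h1 : HasDerivAt (fun r => r * (w ^ 2 * r ^ 3 + 4 * w * M))
      (4 * w ^ 2 * r ^ 3 + 4 * w * M) r := by
    convert! (hasDerivAt_id r).mul ((((hasDerivAt_id r).pow 3).const_mul (w ^ 2)).add_const
      (4 * w * M)) using 1
    simp; ring
  have h2 := h1.sqrt (ksF_radicand_pos hw hM hr).ne'
  convert! ((((hasDerivAt_id r).pow 2).const_mul w).const_add 1).sub h2 using 1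
  simp [ksFDeriv]; ring

theorem continuousOn_ksFDeriv (hw : 0 < w) (hM : 0 < M) :
    ContinuousOn (ksFDeriv w M) (Ioi 0) := by
  unfold ksFDeriv
  refine ContinuousOn.sub (by fun_prop) (ContinuousOn.div (by fun_prop) (by fun_prop) ?_)
  intro r hr
  have := Real.sqrt_pos.2 (ksF_radicand_pos hw hM hr)
  positivity

/-- The superpotential `√f / r` as a function of the tortoise coordinate. -/
noncomputable def superpotential (w M x : ℝ) : ℝ := √(ksF w M (radius w M x)) / radius w M x

/-- The derivative of the superpotential with respect to the tortoise coordinate. -/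
noncomputable def superpotentialDeriv (w M x : ℝ) : ℝ :=
  (ksFDeriv w M (radius w M x) * ksF w M (radius w M x) / (2 * √(ksF w M (radius w M x))) *
    radius w M x - √(ksF w M (radius w M x)) * ksF w M (radius w M x)) / radius w M x ^ 2

theorem continuousOn_one_div_ksF (hw : 0 < w) (hnaked : w * M ^ 2 < 1 / 2) :
    ContinuousOn (fun s => 1 / ksF w M s) (Ici 0) :=
  continuousOn_const.div continuous_ksF.continuousOn fun _ _ => (ksF_pos hw hnaked _).ne'

/-! ### The tortoise coordinate, its inverse and the superpotential. -/

variable (hw : 0 < w) (hM : 0 < M) (hnaked : w * M ^ 2 < 1 / 2)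
include hw hM hnaked

theorem intervalIntegrable_one_div_ksF {a b : ℝ} (ha : 0 ≤ a) (hb : 0 ≤ b) :
    IntervalIntegrable (fun s => 1 / ksF w M s) volume a b :=
  ((continuousOn_one_div_ksF hw hnaked).mono
    ((convex_Ici 0).ordConnected.uIcc_subset ha hb)).intervalIntegrable

theorem hasDerivAt_tortoise {r : ℝ} (hr : 0 < r) :
    HasDerivAt (tortoise w M) (1 / ksF w M r) r := by
  have hc := continuousOn_one_div_ksF hw hnaked
  exact intervalIntegral.integral_hasDerivAt_right
    (intervalIntegrable_one_div_ksF hw hM hnaked le_rfl hr.le)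
    ((hc.mono Ioi_subset_Ici_self).stronglyMeasurableAtFilter isOpen_Ioi r hr)
    (hc.continuousAt (Ici_mem_nhds hr))

theorem continuousOn_tortoise : ContinuousOn (tortoise w M) (Ici 0) := by
  intro r hr
  have h := intervalIntegral.continuousOn_primitive_interval (μ := volume) (a := 0) (b := r + 1)
    (f := fun s => 1 / ksF w M s) (((continuousOn_one_div_ksF hw hnaked).mono
      ((convex_Ici 0).ordConnected.uIcc_subset self_mem_Ici
        (by simp at hr ⊢; linarith))).integrableOn_uIcc)
  have hr' : (0 : ℝ) ≤ r := hr
  rw [uIcc_of_le (by linarith)] at h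
  refine (h r ⟨hr, by linarith⟩).mono_of_mem_nhdsWithin ?_
  filter_upwards [self_mem_nhdsWithin, mem_nhdsWithin_of_mem_nhds (Iio_mem_nhds (lt_add_one r))]
    with s hs hs'
  exact ⟨hs, le_of_lt hs'⟩

theorem strictMonoOn_tortoise : StrictMonoOn (tortoise w M) (Ici 0) := by
  refine strictMonoOn_of_deriv_pos (convex_Ici 0) (continuousOn_tortoise hw hM hnaked) ?_
  intro r hr
  rw [interior_Ici] at hr
  rw [(hasDerivAt_tortoise hw hM hnaked hr).deriv]
  exact one_div_pos.2 (ksF_pos hw hnaked _)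

/-- Follows from `f ≤ 1`. It makes the tortoise coordinate surjective onto `(0,∞)`, and it lets
lower bounds in terms of `r` be traded for bounds in terms of `x` near the singularity. -/
theorem le_tortoise {r : ℝ} (hr : 0 ≤ r) : r ≤ tortoise w M r := by
  have h := intervalIntegral.integral_mono_on (μ := volume) hr
    (intervalIntegrable_const (c := (1 : ℝ)))
    (intervalIntegrable_one_div_ksF hw hM hnaked le_rfl hr) (fun s hs => by
      rw [le_div_iff₀ (ksF_pos hw hnaked _), one_mul]
      exact ksF_le_one hw hM hs.1)
  simpa [tortoise] using h

theorem bijOn_tortoise : BijOn (tortoise w M) (Ioi 0) (Ioi 0) := by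
  refine ⟨fun r hr => lt_of_lt_of_le hr (le_tortoise hw hM hnaked (le_of_lt hr)),
    ((strictMonoOn_tortoise hw hM hnaked).mono Ioi_subset_Ici_self).injOn, fun x hx => ?_⟩
  have hx' : (0 : ℝ) < x := hx
  obtain ⟨r, hr, rfl⟩ := intermediate_value_Icc hx'.le
    ((continuousOn_tortoise hw hM hnaked).mono Icc_subset_Ici_self)
    (show x ∈ Icc (tortoise w M 0) (tortoise w M x) from
      ⟨by simpa [tortoise] using hx'.le, le_tortoise hw hM hnaked hx'.le⟩)
  refine ⟨r, lt_of_le_of_ne hr.1 ?_, rfl⟩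
  rintro rfl
  simp [tortoise] at hx

theorem radius_pos {x : ℝ} (hx : 0 < x) : 0 < radius w M x :=
  (bijOn_tortoise hw hM hnaked).surjOn.mapsTo_invFunOn hx

theorem tortoise_radius {x : ℝ} (hx : 0 < x) : tortoise w M (radius w M x) = x :=
  (bijOn_tortoise hw hM hnaked).surjOn.rightInvOn_invFunOn hx

theorem radius_tortoise {r : ℝ} (hr : 0 < r) : radius w M (tortoise w M r) = r :=
  (bijOn_tortoise hw hM hnaked).injOn.leftInvOn_invFunOn hr

theorem radius_le {x : ℝ} (hx : 0 < x) : radius w M x ≤ x := by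
  conv_rhs => rw [← tortoise_radius hw hM hnaked hx]
  exact le_tortoise hw hM hnaked (radius_pos hw hM hnaked hx).le

theorem monotoneOn_radius : MonotoneOn (radius w M) (Ioi 0) := by
  intro x hx y hy hxy
  rw [← (strictMonoOn_tortoise hw hM hnaked).le_iff_le (radius_pos hw hM hnaked hx).le
    (radius_pos hw hM hnaked hy).le, tortoise_radius hw hM hnaked hx,
    tortoise_radius hw hM hnaked hy]
  exact hxy

theorem continuousAt_radius {x : ℝ} (hx : 0 < x) : ContinuousAt (radius w M) x := by
  refine continuousAt_of_monotoneOn_of_image_mem_nhds (monotoneOn_radius hw hM hnaked)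
    (Ioi_mem_nhds hx) ?_
  refine mem_of_superset (Ioi_mem_nhds (radius_pos hw hM hnaked hx)) fun r hr => ?_
  exact ⟨tortoise w M r, (bijOn_tortoise hw hM hnaked).mapsTo hr, radius_tortoise hw hM hnaked hr⟩

theorem hasDerivAt_radius {x : ℝ} (hx : 0 < x) :
    HasDerivAt (radius w M) (ksF w M (radius w M x)) x := by
  have hr := radius_pos hw hM hnaked hx
  have h := (hasDerivAt_tortoise hw hM hnaked hr).of_local_left_inverse
    (continuousAt_radius hw hM hnaked hx) (one_div_pos.2 (ksF_pos hw hnaked _)).ne'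
    (by filter_upwards [Ioi_mem_nhds hx] with y hy using tortoise_radius hw hM hnaked hy)
  simpa using h

theorem hasDerivAt_superpotential {x : ℝ} (hx : 0 < x) :
    HasDerivAt (superpotential w M) (superpotentialDeriv w M x) x := by
  have hr := radius_pos hw hM hnaked hx
  have h := hasDerivAt_radius hw hM hnaked hx
  exact (((hasDerivAt_ksF hw hM hr).comp x h).sqrt (ksF_pos hw hnaked _).ne').div h hr.ne'

theorem continuousOn_radius : ContinuousOn (radius w M) (Ioi 0) := fun _ hx =>
  (continuousAt_radius hw hM hnaked hx).continuousWithinAt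

theorem continuousOn_superpotentialDeriv : ContinuousOn (superpotentialDeriv w M) (Ioi 0) := by
  have hr := continuousOn_radius hw hM hnaked
  have hf : ContinuousOn (fun x => ksF w M (radius w M x)) (Ioi 0) :=
    continuous_ksF.comp_continuousOn hr
  have hf' : ContinuousOn (fun x => ksFDeriv w M (radius w M x)) (Ioi 0) :=
    (continuousOn_ksFDeriv hw hM).comp hr fun x hx => radius_pos hw hM hnaked hx
  refine ContinuousOn.div ((((hf'.mul hf).div (continuousOn_const.mul hf.sqrt) ?_).mul hr).sub
    (hf.sqrt.mul hf)) (hr.pow 2) ?_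
  · intro x hx
    have := Real.sqrt_pos.2 (ksF_pos hw hnaked (radius w M x))
    exact (mul_pos two_pos this).ne'
  · intro x hx
    exact (pow_pos (radius_pos hw hM hnaked hx) 2).ne'

theorem superpotential_pos {x : ℝ} (hx : 0 < x) : 0 < superpotential w M x :=
  div_pos (Real.sqrt_pos.2 (ksF_pos hw hnaked _))
    (radius_pos hw hM hnaked hx)

theorem superpotential_mul_radius {x : ℝ} (hx : 0 < x) :
    superpotential w M x * radius w M x = √(ksF w M (radius w M x)) :=
  div_mul_cancel₀ _ (radius_pos hw hM hnaked hx).ne'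

theorem superpotential_mul_radius_sq {x : ℝ} (hx : 0 < x) :
    (superpotential w M x * radius w M x) ^ 2 = ksF w M (radius w M x) := by
  rw [superpotential_mul_radius hw hM hnaked hx,
    Real.sq_sqrt (ksF_pos hw hnaked _).le]

theorem superpotential_mul_radius_le_one {x : ℝ} (hx : 0 < x) :
    superpotential w M x * radius w M x ≤ 1 := by
  rw [superpotential_mul_radius hw hM hnaked hx]
  exact Real.sqrt_le_one.2 (ksF_le_one hw hM (radius_pos hw hM hnaked hx).le)

theorem diracPotential_eq (lam ε : ℝ) {x : ℝ} (hx : 0 < x) :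
    diracPotential w M lam ε x =
      lam ^ 2 * superpotential w M x ^ 2 + ε * lam * superpotentialDeriv w M x := by
  have h1 : deriv (fun y => √(ksF w M (radius w M y)) / radius w M y) x =
      superpotentialDeriv w M x := (hasDerivAt_superpotential hw hM hnaked hx).deriv
  rw [diracPotential, h1, superpotential, div_pow,
    Real.sq_sqrt (ksF_pos hw hnaked _).le]
  ring

theorem continuousOn_diracPotential (lam ε : ℝ) :
    ContinuousOn (diracPotential w M lam ε) (Ioi 0) := by
  have hs : ContinuousOn (superpotential w M) (Ioi 0) := fun x hx =>
    (hasDerivAt_superpotential hw hM hnaked hx).continuousAt.continuousWithinAt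
  exact ((continuousOn_const.mul (hs.pow 2)).add
    (continuousOn_const.mul (continuousOn_superpotentialDeriv hw hM hnaked))).congr
    fun x hx => diracPotential_eq hw hM hnaked lam ε hx

end Background

/-! ## Zero-energy solutions of `-ψ'' + (s² g² + s g') ψ = 0` -/

theorem SolvesOn.ofReal {V h h' : ℝ → ℝ} {S : Set ℝ}
    (h1 : ∀ x ∈ S, HasDerivAt h (h' x) x ∧ HasDerivAt h' (V x * h x) x) :
    SolvesOn V 0 (fun x => (h x : ℂ)) (fun x => (h' x : ℂ)) S := fun x hx =>
  ⟨(h1 x hx).1.ofReal_comp, by simpa using (h1 x hx).2.ofReal_comp⟩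

theorem not_memLp_Ioi_of_le {h : ℝ → ℝ} {c : ℝ} (hc : 0 < c) (hcont : ContinuousOn h (Ioi 0))
    (hle : ∀ x ≥ 1, c ≤ h x) :
    ¬ MemLp (fun x => (h x : ℂ)) 2 (volume.restrict (Ioi (1 : ℝ))) := by
  intro hm
  have hcont' : ContinuousOn (fun x => (h x : ℂ)) (Ioi 0) :=
    Complex.continuous_ofReal.comp_continuousOn hcont
  rw [integrable_norm_sq_iff_memLp measurableSet_Ioi
    (hcont'.mono (Ioi_subset_Ioi zero_le_one))] at hm
  have : IntegrableOn (fun _ : ℝ => c ^ 2) (Ioi (1 : ℝ)) := by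
    refine Integrable.mono' hm aestronglyMeasurable_const ?_
    filter_upwards [ae_restrict_mem measurableSet_Ioi] with x hx
    have := hle x (le_of_lt hx)
    rw [Complex.norm_real, Real.norm_eq_abs, Real.norm_eq_abs, sq_abs, abs_of_nonneg (by positivity)]
    gcongr
  rw [integrableOn_const_iff] at this
  simp [hc.ne'] at this

/-- Comparison with `1/x`, whose integral diverges at zero. -/
theorem not_memLp_Ioo_of_le {h : ℝ → ℝ} {c : ℝ} (hc : 0 < c) (hcont : ContinuousOn h (Ioi 0))
    (hle : ∀ x, 0 < x → x ≤ 1 → c ≤ h x ^ 2 * x) :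
    ¬ MemLp (fun x => (h x : ℂ)) 2 (volume.restrict (Ioo (0 : ℝ) 1)) := by
  intro hm
  have hcont' : ContinuousOn (fun x => (h x : ℂ)) (Ioi 0) :=
    Complex.continuous_ofReal.comp_continuousOn hcont
  rw [integrable_norm_sq_iff_memLp measurableSet_Ioo (hcont'.mono Ioo_subset_Ioi_self)] at hm
  have h1 : IntegrableOn (fun x : ℝ => x⁻¹) (Ioo (0 : ℝ) 1) := by
    refine Integrable.mono' (hm.const_mul c⁻¹) measurable_inv.aestronglyMeasurable ?_
    filter_upwards [ae_restrict_mem measurableSet_Ioo] with x hx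
    have := hle x hx.1 hx.2.le
    rw [Complex.norm_real, Real.norm_eq_abs, Real.norm_eq_abs, sq_abs,
      abs_of_pos (inv_pos.2 hx.1), inv_le_iff_one_le_mul₀ hx.1, mul_assoc,
      ← div_eq_inv_mul, one_le_div hc]
    exact this
  rw [← integrableOn_Ioc_iff_integrableOn_Ioo,
    ← intervalIntegrable_iff_integrableOn_Ioc_of_le zero_le_one, intervalIntegrable_inv_iff] at h1
  simp at h1

theorem hasDerivAt_integral_one {h : ℝ → ℝ} (hh : ContinuousOn h (Ioi 0)) {x : ℝ} (hx : 0 < x) :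
    HasDerivAt (fun x => ∫ t in (1 : ℝ)..x, h t) (h x) x :=
  intervalIntegral.integral_hasDerivAt_right
    (hh.mono ((convex_Ioi 0).ordConnected.uIcc_subset (mem_Ioi.2 one_pos) hx)).intervalIntegrable
    (hh.stronglyMeasurableAtFilter isOpen_Ioi x hx) (hh.continuousAt (Ioi_mem_nhds hx))

section

variable {g g' r : ℝ → ℝ} (hg : ∀ x > 0, HasDerivAt g (g' x) x)
include hg

/-- `p` and its first integral `I = ∫ p⁻²`, both normalized at `x = 1`. -/
theorem exists_zeroEnergy_pair (s : ℝ) : ∃ l p I : ℝ → ℝ, l 1 = 0 ∧ p 1 = 1 ∧ I 1 = 0 ∧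
    (∀ x, p x = Real.exp (s * l x)) ∧ ∀ x > 0, HasDerivAt l (g x) x ∧
      HasDerivAt p (s * g x * p x) x ∧ HasDerivAt I (1 / p x ^ 2) x := by
  have hgc : ContinuousOn g (Ioi 0) := fun x hx => (hg x hx).continuousAt.continuousWithinAt
  have hl : ∀ x > 0, HasDerivAt (fun x => ∫ t in (1 : ℝ)..x, g t) (g x) x := fun x hx =>
    hasDerivAt_integral_one hgc hx
  have hp : ∀ x > 0, HasDerivAt (fun x => Real.exp (s * ∫ t in (1 : ℝ)..x, g t))
      (s * g x * Real.exp (s * ∫ t in (1 : ℝ)..x, g t)) x := fun x hx => by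
    convert! ((hl x hx).const_mul s).exp using 1
    ring
  refine ⟨_, _, fun x => ∫ t in (1 : ℝ)..x, 1 / Real.exp (s * ∫ u in (1 : ℝ)..t, g u) ^ 2,
    by simp, by simp, by simp, fun x => rfl, fun x hx => ⟨hl x hx, hp x hx, ?_⟩⟩
  refine hasDerivAt_integral_one (continuousOn_const.div (ContinuousOn.pow (fun y hy =>
    (hp y hy).continuousAt.continuousWithinAt) 2) fun y _ => (pow_pos (Real.exp_pos _) 2).ne') hx

/-- The factorization `-d²/dx² + s² g² + s g' = -(d/dx + s g)(d/dx - s g)`: a function killed by the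
right factor is a zero-energy solution. -/
theorem solves_zeroEnergy {s : ℝ} {p : ℝ → ℝ} (hp : ∀ x > 0, HasDerivAt p (s * g x * p x) x) :
    ∀ x ∈ Ioi (0 : ℝ), HasDerivAt p (s * g x * p x) x ∧
      HasDerivAt (fun x => s * g x * p x) ((s ^ 2 * g x ^ 2 + s * g' x) * p x) x := fun x hx => by
  refine ⟨hp x hx, ?_⟩
  convert! ((hg x hx).const_mul s).mul (hp x hx) using 1
  ring

/-- Reduction of order. The constant `c` will be `1` at infinity and `-1` at zero, so that `1 + c I`
is at least `1` on the side of `x = 1` under consideration. -/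
theorem solves_zeroEnergy_second {s c : ℝ} {p I : ℝ → ℝ} (hp0 : ∀ x, 0 < p x)
    (hp : ∀ x > 0, HasDerivAt p (s * g x * p x) x) (hI : ∀ x > 0, HasDerivAt I (1 / p x ^ 2) x) :
    ∀ x ∈ Ioi (0 : ℝ),
      HasDerivAt (fun x => p x * (1 + c * I x)) (s * g x * (p x * (1 + c * I x)) + c / p x) x ∧
      HasDerivAt (fun x => s * g x * (p x * (1 + c * I x)) + c / p x)
        ((s ^ 2 * g x ^ 2 + s * g' x) * (p x * (1 + c * I x))) x := fun x hx => by
  have hne := (hp0 x).ne'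
  have h1 : HasDerivAt (fun x => p x * (1 + c * I x))
      (s * g x * (p x * (1 + c * I x)) + c / p x) x := by
    convert! (hp x hx).mul (((hI x hx).const_mul c).const_add 1) using 1
    field_simp
  refine ⟨h1, ?_⟩
  convert! (((hg x hx).const_mul s).mul h1).add ((hasDerivAt_const x c).div (hp x hx) hne) using 1
  field_simp
  ring

/-! ### Zero-energy solutions that are not square integrable at an endpoint. -/

variable (hg0 : ∀ x > 0, 0 < g x) (hr : ∀ x > 0, HasDerivAt r ((g x * r x) ^ 2) x)
  (hr0 : ∀ x > 0, 0 < r x) (hgr : ∀ x > 0, g x * r x ≤ 1)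
include hg0 hr hr0 hgr

/-- At infinity there is a zero-energy solution that is not square integrable. -/
theorem exists_zeroEnergy_not_memLp_atTop (s : ℝ) {V : ℝ → ℝ}
    (hV : ∀ x > 0, V x = s ^ 2 * g x ^ 2 + s * g' x) :
    ∃ q q', SolvesOn V 0 q q' (Ioi 0) ∧ ¬ MemLp q 2 (volume.restrict (Ioi 1)) := by
  obtain ⟨l, p, I, hl1, hp1, hI1, hpe, hd⟩ := exists_zeroEnergy_pair hg s
  have hp0 : ∀ x, 0 < p x := fun x => by rw [hpe]; exact Real.exp_pos _
  have hlmono : MonotoneOn l (Ici 1) := by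
    refine monotoneOn_of_hasDerivWithinAt_nonneg (f' := g) (convex_Ici 1)
      (fun x hx => (hd x (lt_of_lt_of_le one_pos hx)).1.continuousAt.continuousWithinAt)
      (fun x hx => ?_) fun x hx => ?_
    · rw [interior_Ici] at hx
      exact (hd x (one_pos.trans hx)).1.hasDerivWithinAt
    · rw [interior_Ici] at hx
      exact (hg0 x (one_pos.trans hx)).le
  have hl0 : ∀ x ≥ 1, 0 ≤ l x := fun x hx => by
    have := hlmono self_mem_Ici hx hx
    rwa [hl1] at this
  rcases le_total 0 s with hs | hs
  · refine ⟨_, _, SolvesOn.ofReal (h' := fun x => s * g x * p x) (h := p) fun x hx => ?_,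
      not_memLp_Ioi_of_le one_pos (fun x hx => (hd x hx).2.1.continuousAt.continuousWithinAt)
        fun x hx => ?_⟩
    · rw [hV x hx]
      exact solves_zeroEnergy hg (fun x hx => (hd x hx).2.1) x hx
    · rw [hpe]
      exact Real.one_le_exp (mul_nonneg hs (hl0 x hx))
  · have hq := solves_zeroEnergy_second hg (c := 1) hp0 (fun x hx => (hd x hx).2.1)
      (fun x hx => (hd x hx).2.2)
    set q := fun x => p x * (1 + 1 * I x) with hqdef
    have hIpos : ∀ x ≥ 1, 0 ≤ I x := fun x hx => by
      have hI : MonotoneOn I (Ici 1) := by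
        refine monotoneOn_of_hasDerivWithinAt_nonneg (f' := fun x => 1 / p x ^ 2) (convex_Ici 1)
          (fun x hx => (hd x (lt_of_lt_of_le one_pos hx)).2.2.continuousAt.continuousWithinAt)
          (fun x hx => ?_) fun x hx => by positivity
        rw [interior_Ici] at hx
        exact (hd x (one_pos.trans hx)).2.2.hasDerivWithinAt
      have := hI self_mem_Ici hx hx
      rwa [hI1] at this
    have hq0 : ∀ x ≥ 1, 0 ≤ q x := fun x hx =>
      mul_nonneg (hp0 x).le (by linarith [hIpos x hx])
    have hrmono : MonotoneOn r (Ici 1) := by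
      refine monotoneOn_of_hasDerivWithinAt_nonneg (f' := fun x => (g x * r x) ^ 2) (convex_Ici 1)
        (fun x hx => (hr x (lt_of_lt_of_le one_pos hx)).continuousAt.continuousWithinAt)
        (fun x hx => ?_) fun x hx => by positivity
      rw [interior_Ici] at hx
      exact (hr x (one_pos.trans hx)).hasDerivWithinAt
    have hgb : ∀ x ≥ 1, g x ≤ 1 / r 1 := fun x hx => by
      have hx0 : (0 : ℝ) < x := lt_of_lt_of_le one_pos hx
      rw [le_div_iff₀ (hr0 1 one_pos)]
      exact (mul_le_mul_of_nonneg_left (hrmono self_mem_Ici hx hx) (hg0 x hx0).le).trans (hgr x hx0)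
    -- Here `s ≤ 0`, so `p ≤ 1` and `-s g ≤ -s / r 1` on `[1,∞)`. Hence `q' = s g q + 1/p ≥ -C q +
    -- 1`, whose equilibrium `1/C` is at most `q 1 = 1`.
    set C := max 1 (-s / r 1) with hC
    have hC1 : 1 ≤ C := le_max_left _ _
    have hC0 : 0 < C := by linarith
    -- Grönwall's argument with an integrating factor: `q` starts above `1/C` and cannot fall below
    -- it.
    have hmono : MonotoneOn (fun x => (q x - 1 / C) * Real.exp (C * x)) (Ici 1) := by
      have hder : ∀ x > 0, HasDerivAt (fun x => (q x - 1 / C) * Real.exp (C * x))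
          ((s * g x * q x + 1 / p x) * Real.exp (C * x) +
            (q x - 1 / C) * (Real.exp (C * x) * (C * 1))) x := fun x hx =>
        ((hq x hx).1.sub_const _).mul (((hasDerivAt_id x).const_mul C).exp)
      refine monotoneOn_of_hasDerivWithinAt_nonneg (convex_Ici 1)
        (fun x hx => (hder x (lt_of_lt_of_le one_pos hx)).continuousAt.continuousWithinAt)
        (fun x hx => (hder x ?_).hasDerivWithinAt) fun x hx => ?_
      · rw [interior_Ici] at hx
        exact one_pos.trans hx
      · rw [interior_Ici] at hx
        have hx1 : 1 ≤ x := le_of_lt hx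
        have hple : p x ≤ 1 := by
          rw [hpe]
          exact Real.exp_le_one_iff.2 (mul_nonpos_of_nonpos_of_nonneg hs (hl0 x hx1))
        have h1p : 1 ≤ 1 / p x := (one_le_div (hp0 x)).2 hple
        have hsg : -C ≤ s * g x := by
          have h2 : -s / r 1 ≤ C := le_max_right _ _
          have h3 : -s * g x ≤ -s * (1 / r 1) := mul_le_mul_of_nonneg_left (hgb x hx1) (by linarith)
          have h4 : -s * (1 / r 1) = -s / r 1 := by ring
          linarith
        have h5 : -C * q x ≤ s * g x * q x := mul_le_mul_of_nonneg_right hsg (hq0 x hx1)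
        have h6 : (q x - 1 / C) * (C * 1) = C * q x - 1 := by field_simp
        have h7 : (s * g x * q x + 1 / p x) * Real.exp (C * x) +
            (q x - 1 / C) * (Real.exp (C * x) * (C * 1)) =
            Real.exp (C * x) * (s * g x * q x + 1 / p x + (q x - 1 / C) * (C * 1)) := by ring
        rw [h7, h6]
        exact mul_nonneg (Real.exp_pos _).le (by linarith)
    refine ⟨_, _, SolvesOn.ofReal (h := q) (h' := fun x => s * g x * q x + 1 / p x) fun x hx => ?_,
      not_memLp_Ioi_of_le (c := 1 / C) (by positivity)
        (fun x hx => (hq x hx).1.continuousAt.continuousWithinAt) fun x hx => ?_⟩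
    · rw [hV x hx]
      exact hq x hx
    · have h1 := hmono self_mem_Ici hx hx
      have h2 : q 1 = 1 := by simp [hqdef, hp1, hI1]
      have h3 : 1 / C ≤ 1 := (div_le_one hC0).2 hC1
      simp only [h2] at h1
      have h4 : 0 ≤ (q x - 1 / C) * Real.exp (C * x) :=
        (mul_nonneg (by linarith) (Real.exp_pos _).le).trans h1
      have := nonneg_of_mul_nonneg_left h4 (Real.exp_pos _)
      linarith

/-- Where `g` behaves like `1/x`, the potential behaves like `(s² - s)/x²`, and `3/4` is the
classical limit point threshold for inverse-square potentials. No asymptotics are needed: comparing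
logarithmic derivatives with that of `r`, which is `g (g r) ≤ g`, suffices. -/
theorem exists_zeroEnergy_not_memLp_zero {s : ℝ} (hs : 3 / 4 ≤ s ^ 2 - s)
    (hrx : ∀ x > 0, r x ≤ x) {V : ℝ → ℝ} (hV : ∀ x > 0, V x = s ^ 2 * g x ^ 2 + s * g' x) :
    ∃ q q', SolvesOn V 0 q q' (Ioi 0) ∧ ¬ MemLp q 2 (volume.restrict (Ioo 0 1)) := by
  obtain ⟨l, p, I, hl1, hp1, hI1, hpe, hd⟩ := exists_zeroEnergy_pair hg s
  have hp0 : ∀ x, 0 < p x := fun x => by rw [hpe]; exact Real.exp_pos _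
  have hr1 := hr0 1 one_pos
  have hgg : ∀ x > 0, g x * (g x * r x) ≤ g x := fun x hx =>
    mul_le_of_le_one_right (hg0 x hx).le (hgr x hx)
  have hint : interior (Ioc (0 : ℝ) 1) = Ioo 0 1 := interior_Ioc
  -- The hypothesis factors as `(s + 1/2)(s - 3/2) ≥ 0`.
  rcases le_or_gt s (-1 / 2) with hs1 | hs1
  -- The logarithmic derivative is at most `(2 s + 1) g ≤ 0`, so `p² r ≥ r 1` on `(0,1]`.
  · have hanti : AntitoneOn (fun x => p x ^ 2 * r x) (Ioc 0 1) := by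
      have hder : ∀ x > 0, HasDerivAt (fun x => p x ^ 2 * r x)
          (p x ^ 2 * r x * (2 * s * g x + g x * (g x * r x))) x := fun x hx => by
        convert! ((hd x hx).2.1.pow 2).mul (hr x hx) using 1
        simp only [Pi.pow_apply]
        ring
      refine antitoneOn_of_hasDerivWithinAt_nonpos (convex_Ioc 0 1)
        (fun x hx => (hder x hx.1).continuousAt.continuousWithinAt)
        (fun x hx => (hder x (hint ▸ hx).1).hasDerivWithinAt) fun x hx => ?_
      rw [hint] at hx
      refine mul_nonpos_of_nonneg_of_nonpos (mul_nonneg (sq_nonneg _) (hr0 x hx.1).le) ?_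
      nlinarith [hgg x hx.1, hg0 x hx.1]
    refine ⟨_, _, SolvesOn.ofReal (h' := fun x => s * g x * p x) (h := p) fun x hx => ?_,
      not_memLp_Ioo_of_le hr1 (fun x hx => (hd x hx).2.1.continuousAt.continuousWithinAt)
        fun x hx hx1 => ?_⟩
    · rw [hV x hx]
      exact solves_zeroEnergy hg (fun x hx => (hd x hx).2.1) x hx
    · have := hanti ⟨hx, hx1⟩ (right_mem_Ioc.2 one_pos) hx1
      simp only [hp1, one_pow, one_mul] at this
      exact this.trans (mul_le_mul_of_nonneg_left (hrx x hx) (sq_nonneg _))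
  · have hs2 : 3 / 2 ≤ s := by nlinarith
    have hpr : ∀ x, 0 < x → x ≤ 1 → p x ^ 2 * r 1 ^ 3 ≤ r x ^ 3 := fun x hx hx1 => by
      -- The logarithmic derivative is at least `(2 s - 3) g ≥ 0`. So `p` is `O(r^(3/2))` at zero,
      -- and the second solution must be the large one.
      have hmono : MonotoneOn (fun x => p x ^ 2 / r x ^ 3) (Ioc 0 1) := by
        have hder : ∀ x > 0, HasDerivAt (fun x => p x ^ 2 / r x ^ 3)
            (p x ^ 2 / r x ^ 3 * (2 * s * g x - 3 * (g x * (g x * r x)))) x := fun x hx => by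
          have := (hr0 x hx).ne'
          convert! ((hd x hx).2.1.pow 2).div ((hr x hx).pow 3) (pow_ne_zero 3 this) using 1
          simp only [Pi.pow_apply, Nat.cast_ofNat, Nat.add_one_sub_one]
          field_simp
        refine monotoneOn_of_hasDerivWithinAt_nonneg (convex_Ioc 0 1)
          (fun x hx => (hder x hx.1).continuousAt.continuousWithinAt)
          (fun x hx => (hder x (hint ▸ hx).1).hasDerivWithinAt) fun x hx => ?_
        rw [hint] at hx
        have := hr0 x hx.1
        refine mul_nonneg (by positivity) ?_
        nlinarith [hgg x hx.1, hg0 x hx.1]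
      have := hmono ⟨hx, hx1⟩ (right_mem_Ioc.2 one_pos) hx1
      simp only [hp1, one_pow] at this
      have h3 := hr0 x hx
      rw [div_le_div_iff₀ (by positivity) (by positivity)] at this
      linarith
    have hq := solves_zeroEnergy_second hg (c := -1) hp0 (fun x hx => (hd x hx).2.1)
      (fun x hx => (hd x hx).2.2)
    set q := fun x => p x * (1 + -1 * I x) with hqdef
    have hI0 : ∀ x, 0 < x → x ≤ 1 → I x ≤ 0 := fun x hx hx1 => by
      have hI : MonotoneOn I (Ioc 0 1) := by
        refine monotoneOn_of_hasDerivWithinAt_nonneg (f' := fun x => 1 / p x ^ 2) (convex_Ioc 0 1)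
          (fun x hx => (hd x hx.1).2.2.continuousAt.continuousWithinAt)
          (fun x hx => (hd x (hint ▸ hx).1).2.2.hasDerivWithinAt) fun x hx => by positivity
      have := hI ⟨hx, hx1⟩ (right_mem_Ioc.2 one_pos) hx1
      rwa [hI1] at this
    have hq0 : ∀ x, 0 < x → x ≤ 1 → 0 ≤ q x := fun x hx hx1 =>
      mul_nonneg (hp0 x).le (by linarith [hI0 x hx hx1])
    set K := s + 1 / 2 with hK
    have hK0 : 0 < K := by linarith
    set c₀ := √(r 1 ^ 3) with hc₀
    have hc₀0 : 0 < c₀ := Real.sqrt_pos.2 (by positivity)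
    -- The first bound makes `q √r ≥ c` at `x = 1`; the second gives `K c ≤ c₀`, needed in the
    -- differential inequality.
    set c := min (√(r 1)) (c₀ / K) with hc
    have hc0 : 0 < c := lt_min (Real.sqrt_pos.2 hr1) (by positivity)
    have hcK : K * c ≤ c₀ := by
      have := min_le_right (√(r 1)) (c₀ / K)
      rw [le_div_iff₀ hK0] at this
      linarith
    -- For `u = q √r` one has `u' ≤ K g u - √r / p ≤ K g u - c₀ g ≤ K g (u - c)`. Integrated
    -- backwards from `x = 1` with the factor `exp (-K l)`, this keeps `u ≥ c` on `(0,1]`.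
    have hanti : AntitoneOn (fun x => (q x * √(r x) - c) * Real.exp (-K * l x)) (Ioc 0 1) := by
      have hder : ∀ x > 0, HasDerivAt (fun x => (q x * √(r x) - c) * Real.exp (-K * l x))
          (((s * g x * q x + -1 / p x) * √(r x) + q x * ((g x * r x) ^ 2 / (2 * √(r x)))) *
            Real.exp (-K * l x) +
            (q x * √(r x) - c) * (Real.exp (-K * l x) * (-K * g x))) x := fun x hx =>
        (((hq x hx).1.mul ((hr x hx).sqrt (hr0 x hx).ne')).sub_const c).mul
          ((hd x hx).1.const_mul (-K)).exp
      refine antitoneOn_of_hasDerivWithinAt_nonpos (convex_Ioc 0 1)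
        (fun x hx => (hder x hx.1).continuousAt.continuousWithinAt)
        (fun x hx => (hder x (hint ▸ hx).1).hasDerivWithinAt) fun x hx => ?_
      rw [hint] at hx
      have hrx0 := hr0 x hx.1
      have hρ : 0 < √(r x) := Real.sqrt_pos.2 hrx0
      have hρ2 : √(r x) ^ 2 = r x := Real.sq_sqrt hrx0.le
      have hgx := hg0 x hx.1
      have hqx := hq0 x hx.1 hx.2.le
      have e1 : q x * ((g x * r x) ^ 2 / (2 * √(r x))) =
          q x * √(r x) * (g x * (g x * r x)) / 2 := by
        have h1 : (g x * r x) ^ 2 / (2 * √(r x)) = √(r x) * (g x * (g x * r x)) / 2 := by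
          rw [div_eq_iff (by positivity)]
          linear_combination (-(g x ^ 2 * r x)) * hρ2
        rw [h1]
        ring
      have e2 : q x * √(r x) * (g x * (g x * r x)) ≤ q x * √(r x) * g x :=
        mul_le_mul_of_nonneg_left (hgg x hx.1) (by positivity)
      -- Combines `c₀ p ≤ r^(3/2)`, from the bound on `p² / r³`, with `g r ≤ 1`.
      have e3 : c₀ * g x ≤ √(r x) / p x := by
        have h1 : c₀ * p x ≤ √(r x) * r x := by
          refine (pow_le_pow_iff_left₀ (mul_nonneg hc₀0.le (hp0 x).le) (by positivity) two_ne_zero).1 ?_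
          rw [mul_pow, mul_pow, hρ2, hc₀, Real.sq_sqrt (by positivity)]
          have := hpr x hx.1 hx.2.le
          nlinarith
        rw [le_div_iff₀ (hp0 x)]
        calc c₀ * g x * p x = g x * (c₀ * p x) := by ring
          _ ≤ g x * (√(r x) * r x) := by gcongr
          _ = √(r x) * (g x * r x) := by ring
          _ ≤ √(r x) := mul_le_of_le_one_right hρ.le (hgr x hx.1)
      have e4 : K * c * g x ≤ c₀ * g x := by gcongr
      have e5 : (s * g x * q x + -1 / p x) * √(r x) = s * (q x * √(r x) * g x) - √(r x) / p x := by
        ring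
      have e6 : ((s * g x * q x + -1 / p x) * √(r x) + q x * ((g x * r x) ^ 2 / (2 * √(r x)))) *
            Real.exp (-K * l x) + (q x * √(r x) - c) * (Real.exp (-K * l x) * (-K * g x)) =
          Real.exp (-K * l x) * (s * (q x * √(r x) * g x) - √(r x) / p x +
            q x * √(r x) * (g x * (g x * r x)) / 2 - K * (q x * √(r x) * g x) + K * c * g x) := by
        rw [e1, e5]; ring
      rw [e6]
      refine mul_nonpos_of_nonneg_of_nonpos (Real.exp_pos _).le ?_
      rw [hK] at *
      linarith
    refine ⟨_, _, SolvesOn.ofReal (h := q) (h' := fun x => s * g x * q x + -1 / p x) fun x hx => ?_,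
      not_memLp_Ioo_of_le (c := c ^ 2) (by positivity)
        (fun x hx => (hq x hx).1.continuousAt.continuousWithinAt) fun x hx hx1 => ?_⟩
    · rw [hV x hx]
      exact hq x hx
    · have h1 := hanti ⟨hx, hx1⟩ (right_mem_Ioc.2 one_pos) hx1
      have h2 : q 1 = 1 := by simp [hqdef, hp1, hI1]
      simp only [h2, one_mul] at h1
      have h4 : 0 ≤ (q x * √(r x) - c) * Real.exp (-K * l x) :=
        (mul_nonneg (sub_nonneg.2 (min_le_left _ _)) (Real.exp_pos _).le).trans h1
      have h5 := nonneg_of_mul_nonneg_left h4 (Real.exp_pos _)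
      have h6 : c ^ 2 ≤ (q x * √(r x)) ^ 2 := by gcongr; linarith
      rw [mul_pow, Real.sq_sqrt (hr0 x hx).le] at h6
      exact h6.trans (mul_le_mul_of_nonneg_left (hrx x hx) (sq_nonneg _))

end

/-! ## Reduction of the Chandrasekhar--Dirac equations -/

section Reduction

open Complex (I)

variable {k m : ℝ} {P S : ℝ → ℂ} {t r θ φ : ℝ}

theorem deriv_modeField_t : deriv (fun t' => modeField k m P S t' r θ φ) t =
    I * k * modeField k m P S t r θ φ := by
  have h : HasDerivAt (fun t' : ℝ => I * ((k * t' + m * φ : ℝ) : ℂ)) (I * ((k * 1 : ℝ) : ℂ)) t :=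
    ((((hasDerivAt_id t).const_mul k).add_const (m * φ)).ofReal_comp).const_mul I
  refine ((h.cexp.mul_const (P r)).mul_const (S θ)).deriv.trans ?_
  simp only [modeField, mul_one]
  ring

theorem deriv_modeField_φ : deriv (fun φ' => modeField k m P S t r θ φ') φ =
    I * m * modeField k m P S t r θ φ := by
  have h : HasDerivAt (fun φ' : ℝ => I * ((k * t + m * φ' : ℝ) : ℂ)) (I * ((m * 1 : ℝ) : ℂ)) φ :=
    ((((hasDerivAt_id φ).const_mul m).const_add (k * t)).ofReal_comp).const_mul I
  refine ((h.cexp.mul_const (P r)).mul_const (S θ)).deriv.trans ?_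
  simp only [modeField, mul_one]
  ring

theorem deriv_modeField_r : deriv (fun r' => modeField k m P S t r' θ φ) r =
    Complex.exp (I * (k * t + m * φ : ℝ)) * deriv P r * S θ := by
  simp only [modeField]
  rw [deriv_mul_const_field, deriv_const_mul_field]

theorem deriv_modeField_θ : deriv (fun θ' => modeField k m P S t r θ' φ) θ =
    Complex.exp (I * (k * t + m * φ : ℝ)) * P r * deriv S θ := by
  simp only [modeField]
  rw [deriv_const_mul_field]

/-- The first radial equation from `(D - ρ) F + (δ̄ - α) G = 0`, with `ν = 1` or `-1`
interchanging the two angular functions. -/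
theorem radial_first {ν e r ρ σ S T T' R₁ R₁' R₂ k m lam ct sn : ℂ} (he : e ≠ 0) (hr : r ≠ 0)
    (hρ : ρ ≠ 0) (hσ : σ ≠ 0) (hsn : sn ≠ 0) (hν : ν ^ 2 = 1)
    (hT : T' + (ct / 2 + ν * m / sn) * T = -ν * lam * S)
    (h : 1 / ρ ^ 2 * (I * k * (e * (R₁ / r) * S)) + e * (R₁' / r - R₁ / r ^ 2) * S
      - -1 / r * (e * (R₁ / r) * S)
      + ν * (1 / (σ * r) * (e * (σ * R₂ / (r * ρ)) * T'
          - ν * (I * (1 / sn) * (I * m * (e * (σ * R₂ / (r * ρ)) * T))))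
        - -(ct / (2 * σ * r)) * (e * (σ * R₂ / (r * ρ)) * T)) = 0) :
    S * (R₁' + I * k / ρ ^ 2 * R₁ - lam * R₂ / (r * ρ)) = 0 := by
  -- Eliminating `T'` cancels the cotangent against the spin coefficient and the `m / sin θ` terms
  -- against the `φ`-derivative; a multiple of `S` remains. Here `ρ` stands for `√f`, `σ` for `√2`
  -- and `e` for the exponential.
  have hT' : T' = -ν * lam * S - (ct / 2 + ν * m / sn) * T := by rw [← hT]; ring
  have hI : I * I = -1 := Complex.I_mul_I
  have h2 : S * (R₁' + I * k / ρ ^ 2 * R₁ - lam * R₂ / (r * ρ)) * (e / r) = 0 := by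
    rw [← h, hT']
    field_simp
    linear_combination (2 * ν ^ 2 * ρ * R₂ * m * T) * hI + (2 * ρ * R₂ * lam * S * sn) * hν
  exact (mul_eq_zero.1 h2).resolve_right (div_ne_zero he hr)

/-- The counterpart for the two equations with `Δ`. The term `μ - γ` cancels the derivative of the
prefactor `1 / (r √f)`, and the angular terms cancel as in `radial_first`. Again `ν = ±1`
interchanges the angular functions. -/
theorem radial_second {ν e r ρ σ S T T' R₁ R₂ R₂' F k m lam ct sn : ℂ} (he : e ≠ 0) (hr : r ≠ 0)
    (hρ : ρ ≠ 0) (hσ : σ ≠ 0) (hσ2 : σ ^ 2 = 2) (hsn : sn ≠ 0) (hν : ν ^ 2 = 1)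
    (hT : T' + (ct / 2 - ν * m / sn) * T = ν * lam * S)
    (h : (I * k * (e * (σ * R₂ / (r * ρ)) * S) - ρ ^ 2 * (e * (σ * (R₂' * (r * ρ)
          - R₂ * (ρ + r * (F / (2 * ρ)))) / (r * ρ) ^ 2) * S)) / 2
      + (-ρ ^ 2 / (2 * r) - F / 4) * (e * (σ * R₂ / (r * ρ)) * S)
      + ν * (1 / (σ * r) * (e * (R₁ / r) * T' + ν * (I * (1 / sn) * (I * m * (e * (R₁ / r) * T))))
        + ct / (2 * σ * r) * (e * (R₁ / r) * T)) = 0) :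
    S * (R₂' - I * k / ρ ^ 2 * R₂ - lam * R₁ / (r * ρ)) = 0 := by
  have hT' : T' = ν * lam * S - (ct / 2 - ν * m / sn) * T := by rw [← hT]; ring
  have hI : I * I = -1 := Complex.I_mul_I
  have h2 : S * (R₂' - I * k / ρ ^ 2 * R₂ - lam * R₁ / (r * ρ)) * (-e * σ * ρ / (2 * r)) = 0 := by
    rw [← h, hT']
    field_simp
    linear_combination (8 * ρ * lam * R₁ * S * sn) * hσ2 - (16 * ρ * lam * R₁ * S * sn) * hν -
      (16 * ρ * R₁ * ν ^ 2 * m * T) * hI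
  refine (mul_eq_zero.1 h2).resolve_right ?_
  simp [he, hr, hρ, hσ]

/-- The separated Chandrasekhar--Dirac equations imply the radial system. -/
theorem IsCDMode.radial {f f' : ℝ → ℝ} (hf0 : ∀ r > 0, 0 < f r)
    (hf : ∀ r > 0, HasDerivAt f (f' r) r) {lam : ℝ} {R₁ R₂ S₁ S₂ : ℝ → ℂ}
    (hR₁ : DifferentiableOn ℝ R₁ (Ioi 0)) (hR₂ : DifferentiableOn ℝ R₂ (Ioi 0))
    (hS : IsAngularPair m lam S₁ S₂) (h : IsCDMode f k m R₁ R₂ S₁ S₂) {r : ℝ} (hr : 0 < r) :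
    deriv R₁ r + I * k / (√(f r) : ℂ) ^ 2 * R₁ r - lam * R₂ r / (r * √(f r)) = 0 ∧
    deriv R₂ r - I * k / (√(f r) : ℂ) ^ 2 * R₂ r - lam * R₁ r / (r * √(f r)) = 0 := by
  obtain ⟨⟨θ, hθ, hne⟩, hang⟩ := hS
  obtain ⟨-, -, hS1, hS2⟩ := hang θ hθ
  -- A single angle at which `S₁` or `S₂` is nonzero is enough, since the angular factor can then be
  -- divided out; `t = φ = 0` is an arbitrary choice.
  obtain ⟨h1, h2, h3, h4⟩ := h 0 0 r hr θ hθ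
  have hd1 : HasDerivAt R₁ (deriv R₁ r) r :=
    (hR₁.differentiableAt (Ioi_mem_nhds hr)).hasDerivAt
  have hd2 : HasDerivAt R₂ (deriv R₂ r) r :=
    (hR₂.differentiableAt (Ioi_mem_nhds hr)).hasDerivAt
  have hρ : 0 < √(f r) := Real.sqrt_pos.2 (hf0 r hr)
  have hrc : (r : ℂ) ≠ 0 := by exact_mod_cast hr.ne'
  have hρc : (√(f r) : ℂ) ≠ 0 := by exact_mod_cast hρ.ne'
  have hfr : (f r : ℂ) = (√(f r) : ℂ) ^ 2 := by
    exact_mod_cast (Real.sq_sqrt (hf0 r hr).le).symm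
  have hσ2 : ((√2 : ℝ) : ℂ) ^ 2 = 2 := by exact_mod_cast Real.sq_sqrt (zero_le_two (α := ℝ))
  have hσ : ((√2 : ℝ) : ℂ) ≠ 0 := by
    intro h0; rw [h0] at hσ2; norm_num at hσ2
  have hsn : (Real.sin θ : ℂ) ≠ 0 := by exact_mod_cast (Real.sin_pos_of_mem_Ioo hθ).ne'
  have hP1 : deriv (fun r => R₁ r / (r : ℂ)) r = deriv R₁ r / r - R₁ r / r ^ 2 := by
    have h5 : HasDerivAt (fun r : ℝ => (r : ℂ)) 1 r := (hasDerivAt_id r).ofReal_comp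
    refine (hd1.div h5 hrc).deriv.trans ?_
    field_simp
  have hP2 : deriv (fun r => (√2 : ℝ) * R₂ r / (r * √(f r) : ℝ)) r =
      (√2 : ℝ) * (deriv R₂ r * (r * √(f r)) - R₂ r * (√(f r) + r * (f' r / (2 * √(f r))))) /
        (r * √(f r)) ^ 2 := by
    have h5 := ((hasDerivAt_id r).mul ((hf r hr).sqrt (hf0 r hr).ne')).ofReal_comp
    have h6 := (hd2.const_mul ((√2 : ℝ) : ℂ)).div h5 (by
      simpa using And.intro hrc hρc)
    refine h6.deriv.trans ?_
    simp
    ring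
  have he : Complex.exp (I * (k * 0 + m * 0 : ℝ)) ≠ 0 := Complex.exp_ne_zero _
  simp only [npD, npDelta, npEth, npEthBar, deriv_modeField_t, deriv_modeField_r,
    deriv_modeField_θ, deriv_modeField_φ, hP1, hP2, spinRho, spinMu, spinGamma, spinAlpha,
    spinBeta, (hf r hr).deriv] at h1 h2 h3 h4
  simp only [modeField] at h1 h2 h3 h4
  generalize Complex.exp (I * (k * 0 + m * 0 : ℝ)) = e at h1 h2 h3 h4 he
  generalize Real.cot θ = ct at h1 h2 h3 h4 hS1 hS2
  generalize Real.sin θ = sn at h1 h2 h3 h4 hS1 hS2 hsn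
  push_cast at h1 h2 h3 h4 hS1 hS2
  rw [hfr] at h1 h2 h3 h4
  have a1 : S₁ θ * (deriv R₁ r + I * k / (√(f r) : ℂ) ^ 2 * R₁ r - lam * R₂ r / (r * √(f r))) = 0 :=
    radial_first (ν := 1) (T := S₂ θ) (T' := deriv S₂ θ) (m := m) (ct := ct) he hrc hρc hσ
      hsn (by ring) (by linear_combination hS2) (by linear_combination h1)
  have a2 : S₂ θ * (deriv R₁ r + I * k / (√(f r) : ℂ) ^ 2 * R₁ r - lam * R₂ r / (r * √(f r))) = 0 :=
    radial_first (ν := -1) (T := S₁ θ) (T' := deriv S₁ θ) (m := m) (ct := ct) he hrc hρc hσ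
      hsn (by ring) (by linear_combination hS1) (by linear_combination h3)
  have b1 : S₂ θ * (deriv R₂ r - I * k / (√(f r) : ℂ) ^ 2 * R₂ r - lam * R₁ r / (r * √(f r))) = 0 :=
    radial_second (ν := 1) (T := S₁ θ) (T' := deriv S₁ θ) (m := m) (ct := ct) (F := f' r)
      he hrc hρc hσ hσ2 hsn (by ring) (by linear_combination hS1)
      (by linear_combination h2)
  have b2 : S₁ θ * (deriv R₂ r - I * k / (√(f r) : ℂ) ^ 2 * R₂ r - lam * R₁ r / (r * √(f r))) = 0 :=
    radial_second (ν := -1) (T := S₂ θ) (T' := deriv S₂ θ) (m := m) (ct := ct) (F := f' r)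
      he hrc hρc hσ hσ2 hsn (by ring) (by linear_combination hS2)
      (by linear_combination h4)
  rcases hne with hne | hne
  · exact ⟨(mul_eq_zero.1 a1).resolve_left hne, (mul_eq_zero.1 b2).resolve_left hne⟩
  · exact ⟨(mul_eq_zero.1 a2).resolve_left hne, (mul_eq_zero.1 b1).resolve_left hne⟩

/-- The second-order equation for `Z = R₁ + ε R₂` in the tortoise coordinate. -/
theorem isSolution_of_radial {g g' : ℝ → ℝ} {u₁ u₂ : ℝ → ℂ} {k lam ε : ℝ} {V : ℝ → ℝ}
    (hε : ε ^ 2 = 1) (hg : ∀ x > 0, HasDerivAt g (g' x) x)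
    (hV : ∀ x > 0, V x = lam ^ 2 * g x ^ 2 + ε * lam * g' x)
    (h₁ : ∀ x > 0, HasDerivAt u₁ (-I * k * u₁ x + lam * g x * u₂ x) x)
    (h₂ : ∀ x > 0, HasDerivAt u₂ (I * k * u₂ x + lam * g x * u₁ x) x) :
    IsSolution V ((k : ℂ) ^ 2) (fun x => u₁ x + ε * u₂ x) := by
  have hε' : (ε : ℂ) ^ 2 = 1 := by exact_mod_cast hε
  -- With `Y = u₁ - ε u₂` and `Z = u₁ + ε u₂` the system reads `Z' = -i k Y + ε λ g Z`, `Y' = -i k Z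
  -- - ε λ g Y`. In `Z''` the terms with `Y` cancel.
  refine ⟨fun x => -I * k * (u₁ x - ε * u₂ x) + ε * (lam * g x) * (u₁ x + ε * u₂ x),
    fun x => (V x - k ^ 2) * (u₁ x + ε * u₂ x), fun x hx => ⟨?_, ?_, by ring⟩⟩
  · convert! (h₁ x hx).add ((h₂ x hx).const_mul (ε : ℂ)) using 1
    linear_combination (lam * g x * u₂ x) * hε'
  · have hgc : HasDerivAt (fun x => (g x : ℂ)) (g' x) x := (hg x hx).ofReal_comp
    convert! (((h₁ x hx).sub ((h₂ x hx).const_mul (ε : ℂ))).const_mul (-I * k)).add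
      (((hgc.const_mul (lam : ℂ)).const_mul (ε : ℂ)).mul
        ((h₁ x hx).add ((h₂ x hx).const_mul (ε : ℂ)))) using 1
    have hVc : (V x : ℂ) = lam ^ 2 * g x ^ 2 + ε * lam * g' x := by exact_mod_cast hV x hx
    simp only [hVc, Pi.add_apply]
    linear_combination (-(k ^ 2 * (u₁ x + ε * u₂ x))) * Complex.I_sq -
      (lam * g x * k * u₂ x * I + lam ^ 2 * g x ^ 2 * u₁ x) * hε'

/-- Reduction of the Chandrasekhar--Dirac equations on the Kehagias--Sfetsos background. -/
theorem IsCDMode.isSolution {w M : ℝ} (hw : 0 < w) (hM : 0 < M) (hnaked : w * M ^ 2 < 1 / 2)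
    {lam ε : ℝ} (hε : ε ^ 2 = 1) {R₁ R₂ S₁ S₂ : ℝ → ℂ}
    (hR₁ : DifferentiableOn ℝ R₁ (Ioi 0)) (hR₂ : DifferentiableOn ℝ R₂ (Ioi 0))
    (hS : IsAngularPair m lam S₁ S₂) (h : IsCDMode (ksF w M) k m R₁ R₂ S₁ S₂) :
    IsSolution (diracPotential w M lam ε) ((k : ℂ) ^ 2)
      (fun x => R₁ (radius w M x) + ε * R₂ (radius w M x)) := by
  refine isSolution_of_radial (u₁ := fun x => R₁ (radius w M x))
    (u₂ := fun x => R₂ (radius w M x)) hε (fun x hx => hasDerivAt_superpotential hw hM hnaked hx)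
    (fun x hx => diracPotential_eq hw hM hnaked lam ε hx) (fun x hx => ?_) fun x hx => ?_
  all_goals
    have hr := radius_pos hw hM hnaked hx
    have hρ : 0 < √(ksF w M (radius w M x)) := Real.sqrt_pos.2 (ksF_pos hw hnaked _)
    have hrc : (radius w M x : ℂ) ≠ 0 := by exact_mod_cast hr.ne'
    have hρc : (√(ksF w M (radius w M x)) : ℂ) ≠ 0 := by exact_mod_cast hρ.ne'
    have hfr : (ksF w M (radius w M x) : ℂ) = (√(ksF w M (radius w M x)) : ℂ) ^ 2 := by
      exact_mod_cast (Real.sq_sqrt (ksF_pos hw hnaked _).le).symm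
    obtain ⟨h1, h2⟩ := h.radial (fun r _ => ksF_pos hw hnaked r)
      (fun r hr => hasDerivAt_ksF hw hM hr) hR₁ hR₂ hS hr
  · convert! ((hR₁.differentiableAt (Ioi_mem_nhds hr)).hasDerivAt).scomp x
      (hasDerivAt_radius hw hM hnaked hx) using 1
    rw [Complex.real_smul, hfr, superpotential]
    push_cast
    field_simp at h1 ⊢
    linear_combination -h1
  · convert! ((hR₂.differentiableAt (Ioi_mem_nhds hr)).hasDerivAt).scomp x
      (hasDerivAt_radius hw hM hnaked hx) using 1
    rw [Complex.real_smul, hfr, superpotential]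
    push_cast
    field_simp at h2 ⊢
    linear_combination -h2

end Reduction

/-! ## The basic criterion for essential self-adjointness -/

section Criterion

variable {H : Type*} [NormedAddCommGroup H] [InnerProductSpace ℂ H]
  {A B : H →ₗ.[ℂ] H}

theorem closure_le_of_isClosed (hAB : A ≤ B) (hB : B.IsClosed) : A.closure ≤ B := by
  have hA : A.IsClosable := hB.isClosable.leIsClosable hAB
  refine LinearPMap.le_of_le_graph ?_
  rw [← hA.graph_closure_eq_closure_graph]
  exact Submodule.topologicalClosure_minimal _ (LinearPMap.le_graph_of_le hAB) hB

/-- By symmetry `⟨a, A a⟩` is real, so the imaginary part of `⟨a, (A - i) a⟩` is `-‖a‖²`;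
Cauchy–Schwarz concludes. -/
theorem norm_le_norm_sub_I_smul (hs : A.IsFormalAdjoint A) {a b : H} (hab : (a, b) ∈ A.graph) :
    ‖a‖ ≤ ‖b - Complex.I • a‖ := by
  obtain ⟨x, rfl, rfl⟩ := (LinearPMap.mem_graph_iff A).1 hab
  have h1 : (⟪(x : H), A x⟫_ℂ).im = 0 := by
    have h := hs x x
    rw [← inner_conj_symm] at h
    exact Complex.conj_eq_iff_im.1 h
  have h2 : (⟪(x : H), A x - Complex.I • (x : H)⟫_ℂ).im = -(‖(x : H)‖ * ‖(x : H)‖) := by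
    rw [inner_sub_right, inner_smul_right, inner_self_eq_norm_sq_to_K, Complex.sub_im, h1]
    simp [sq]
  have h3 := (Complex.abs_im_le_norm _).trans
    (norm_inner_le_norm (𝕜 := ℂ) (x : H) (A x - Complex.I • (x : H)))
  rw [h2, abs_neg, abs_of_nonneg (by positivity)] at h3
  rcases (norm_nonneg (x : H)).eq_or_lt with h | h
  · rw [← h]; exact norm_nonneg _
  · exact le_of_mul_le_mul_left h3 h

variable [CompleteSpace H]

theorem mem_graph_adjoint_iff (hA : Dense (A.domain : Set H)) (u v : H) :
    (u, v) ∈ A.adjoint.graph ↔ ∀ a b, (a, b) ∈ A.graph → ⟪b, u⟫_ℂ = ⟪a, v⟫_ℂ := by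
  rw [LinearPMap.adjoint_graph_eq_graph_adjoint hA, Submodule.mem_adjoint_iff]
  simp only [sub_eq_zero]

theorem adjoint_le_adjoint (hA : Dense (A.domain : Set H)) (hAB : A ≤ B) :
    B.adjoint ≤ A.adjoint := by
  have hB : Dense (B.domain : Set H) := hA.mono hAB.1
  refine LinearPMap.le_of_le_graph fun x hx => ?_
  obtain ⟨u, v⟩ := x
  rw [mem_graph_adjoint_iff hB] at hx
  rw [mem_graph_adjoint_iff hA]
  exact fun a b hab => hx a b (LinearPMap.le_graph_of_le hAB hab)

theorem adjoint_closure (hA : Dense (A.domain : Set H)) (hc : A.IsClosable) :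
    A.closure.adjoint = A.adjoint := by
  refine le_antisymm (adjoint_le_adjoint hA A.le_closure) (LinearPMap.le_of_le_graph fun x hx => ?_)
  obtain ⟨u, v⟩ := x
  rw [mem_graph_adjoint_iff hA] at hx
  rw [mem_graph_adjoint_iff (hA.mono A.le_closure.1), ← hc.graph_closure_eq_closure_graph]
  intro a b hab
  have hcl : IsClosed {p : H × H | ⟪p.2, u⟫_ℂ = ⟪p.1, v⟫_ℂ} :=
    isClosed_eq (by fun_prop) (by fun_prop)
  exact closure_minimal (s := (A.graph : Set (H × H))) (fun p hp => hx p.1 p.2 hp) hcl hab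

/-- A densely defined symmetric operator without deficiency is essentially self-adjoint. -/
theorem closure_eq_adjoint (hA : Dense (A.domain : Set H)) (hs : A.IsFormalAdjoint A)
    (hd : ∀ z : ℂ, z.im ≠ 0 → ∀ u, (u, z • u) ∈ A.adjoint.graph → u = 0) :
    A.IsClosable ∧ A.closure = A.adjoint := by
  have hle : A ≤ A.adjoint := hs.le_adjoint hA
  have hclosed : A.adjoint.IsClosed := LinearPMap.adjoint_isClosed hA
  have hc : A.IsClosable := hclosed.isClosable.leIsClosable hle
  refine ⟨hc, le_antisymm (closure_le_of_isClosed hle hclosed) (LinearPMap.le_of_le_graph ?_)⟩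
  rintro ⟨u, v⟩ huv
  let L : H × H →ₗ[ℂ] H := LinearMap.snd ℂ H H - Complex.I • LinearMap.fst ℂ H H
  have hL : ∀ p, L p = p.2 - Complex.I • p.1 := fun p => rfl
  -- The orthogonal complement of the range of `A - i` is the kernel of `A* + i`, which is trivial.
  have hdense : Dense ((A.graph.map L : Submodule ℂ H) : Set H) := by
    rw [Submodule.dense_iff_topologicalClosure_eq_top,
      Submodule.topologicalClosure_eq_top_iff, Submodule.eq_bot_iff]
    intro y hy
    refine hd (-Complex.I) (by simp) y ((mem_graph_adjoint_iff hA _ _).2 fun a b hab => ?_)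
    have h := (Submodule.mem_orthogonal _ _).1 hy (L (a, b)) (Submodule.mem_map_of_mem hab)
    rw [hL, inner_sub_left, inner_smul_left, sub_eq_zero] at h
    rw [h, inner_smul_right]
    simp
  obtain ⟨y, hy, hlim⟩ := mem_closure_iff_seq_limit.1 (hdense (v - Complex.I • u))
  choose p hp hpy using hy
  -- The lower bound for `A - i` makes preimages of a convergent sequence Cauchy, so `v - i u` is
  -- attained by the closure of `A - i` at some `a`.
  have hcauchy : CauchySeq fun n => (p n).1 := by
    refine Metric.cauchySeq_iff'.2 fun ε hε => ?_
    obtain ⟨N, hN⟩ := Metric.cauchySeq_iff'.1 hlim.cauchySeq ε hε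
    refine ⟨N, fun n hn => lt_of_le_of_lt ?_ (hN n hn)⟩
    have h := norm_le_norm_sub_I_smul hs (A.graph.sub_mem (hp n) (hp N))
    rw [dist_eq_norm, dist_eq_norm, ← hpy, ← hpy, ← map_sub, hL]
    exact h
  obtain ⟨a, ha⟩ := cauchySeq_tendsto_of_complete hcauchy
  have hb : Tendsto (fun n => (p n).2) atTop (𝓝 (v - Complex.I • u + Complex.I • a)) := by
    refine (hlim.add (ha.const_smul Complex.I)).congr fun n => ?_
    rw [← hpy, hL, sub_add_cancel]
  have hmem : (a, v - Complex.I • u + Complex.I • a) ∈ A.closure.graph := by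
    rw [← hc.graph_closure_eq_closure_graph]
    exact mem_closure_of_tendsto (ha.prodMk_nhds hb) (.of_forall fun n => hp n)
  have hmem' : (a, v - Complex.I • u + Complex.I • a) ∈ A.adjoint.graph :=
    LinearPMap.le_graph_of_le (closure_le_of_isClosed hle hclosed) hmem
  have hsub := A.adjoint.graph.sub_mem huv hmem'
  -- The adjoint minus `i` takes the same value at `u` and `a`, so `u - a` lies in its trivial
  -- kernel.
  have h0 : u - a = 0 := hd Complex.I (by simp) (u - a) (by
    convert hsub using 1
    ext
    · rfl
    · simp only [smul_sub, Prod.snd_sub]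
      abel)
  rw [sub_eq_zero] at h0
  subst h0
  simpa using hmem

theorem mem_deficiencySubspace_iff {z : ℂ} {u : H} :
    u ∈ deficiencySubspace A z ↔ (u, z • u) ∈ A.adjoint.graph := by
  simp only [deficiencySubspace, Submodule.mem_map, LinearMap.mem_ker, LinearMap.sub_apply,
    LinearMap.smul_apply, Submodule.subtype_apply, sub_eq_zero, LinearPMap.mem_graph_iff]
  constructor
  · rintro ⟨x, hx, rfl⟩
    exact ⟨x, rfl, hx⟩
  · rintro ⟨x, rfl, hx⟩
    exact ⟨x, hx, rfl⟩

theorem deficiencyIndex_eq_zero {z : ℂ} (h : ∀ u, (u, z • u) ∈ A.adjoint.graph → u = 0) :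
    deficiencyIndex A z = 0 := by
  have : deficiencySubspace A z = ⊥ :=
    (Submodule.eq_bot_iff _).2 fun u hu => h u (mem_deficiencySubspace_iff.1 hu)
  rw [deficiencyIndex, this]
  exact rank_bot ℂ H

theorem isEssentiallySelfAdjoint_of_deficiency (hA : Dense (A.domain : Set H))
    (hs : A.IsFormalAdjoint A)
    (hd : ∀ z : ℂ, z.im ≠ 0 → ∀ u, (u, z • u) ∈ A.adjoint.graph → u = 0) :
    IsEssentiallySelfAdjoint A := by
  obtain ⟨hc, he⟩ := closure_eq_adjoint hA hs hd
  refine ⟨hA, hc, ?_⟩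
  rw [LinearPMap.isSelfAdjoint_def, adjoint_closure hA hc, he]

/-- A self-adjoint extension is closed, so it contains the closure; taking adjoints reverses the
inclusion. -/
theorem IsEssentiallySelfAdjoint.isQuantumRegular (h : IsEssentiallySelfAdjoint A) :
    IsQuantumRegular A := by
  obtain ⟨hA, hc, hsa⟩ := h
  refine ⟨A.closure, ⟨A.le_closure, hsa⟩, fun C hC => ?_⟩
  have hle : A.closure ≤ C := closure_le_of_isClosed hC.1 hC.2.isClosed
  refine le_antisymm ?_ hle
  have h := adjoint_le_adjoint hsa.dense_domain hle
  rwa [LinearPMap.isSelfAdjoint_def.1 hC.2, LinearPMap.isSelfAdjoint_def.1 hsa] at h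

end Criterion

/-! ## The du Bois-Reymond lemma on the half-line -/

/-- Real test functions on the open half-line. -/
structure IsHalfLineTest (φ : ℝ → ℝ) : Prop where
  contDiff : ContDiff ℝ ∞ φ
  hasCompactSupport : HasCompactSupport φ
  tsupport_subset : tsupport φ ⊆ Ioi 0

namespace IsHalfLineTest

variable {φ η g h : ℝ → ℝ}

theorem const_mul (c : ℝ) (hφ : IsHalfLineTest φ) : IsHalfLineTest fun x => c * φ x where
  contDiff := contDiff_const.mul hφ.contDiff
  hasCompactSupport := hφ.hasCompactSupport.mul_left
  tsupport_subset := (tsupport_mul_subset_right (f := fun _ => c)).trans hφ.tsupport_subset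

theorem sub (hφ : IsHalfLineTest φ) (hη : IsHalfLineTest η) :
    IsHalfLineTest fun x => φ x - η x where
  contDiff := hφ.contDiff.sub hη.contDiff
  hasCompactSupport := hφ.hasCompactSupport.sub hη.hasCompactSupport
  tsupport_subset := (tsupport_sub φ η).trans (union_subset hφ.tsupport_subset hη.tsupport_subset)

theorem differentiable (hφ : IsHalfLineTest φ) : Differentiable ℝ φ :=
  hφ.contDiff.differentiable (by simp)

theorem deriv (hφ : IsHalfLineTest φ) : IsHalfLineTest (deriv φ) where
  contDiff := (contDiff_infty_iff_deriv.1 hφ.contDiff).2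
  hasCompactSupport := hφ.hasCompactSupport.deriv
  tsupport_subset := tsupport_deriv_subset.trans hφ.tsupport_subset

/-- The interval is enlarged to reach the point `1`, the base point of all primitives below. -/
theorem exists_Ioo (hφ : IsHalfLineTest φ) :
    ∃ c d : ℝ, 0 < c ∧ c ≤ 1 ∧ 1 ≤ d ∧ tsupport φ ⊆ Ioo c d := by
  rcases (tsupport φ).eq_empty_or_nonempty with he | hne
  · exact ⟨1, 1, one_pos, le_rfl, le_rfl, by simp [he]⟩
  · obtain ⟨m, hm, hm'⟩ := hφ.hasCompactSupport.exists_isLeast hne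
    obtain ⟨d, hd, hd'⟩ := hφ.hasCompactSupport.exists_isGreatest hne
    have hm0 : 0 < m := hφ.tsupport_subset hm
    refine ⟨min (m / 2) 1, max (d + 1) 1, lt_min (by linarith) one_pos, min_le_right _ _,
      le_max_right _ _, fun x hx => ⟨?_, ?_⟩⟩
    · exact (min_le_left _ _).trans_lt (by linarith [hm' hx])
    · exact lt_of_lt_of_le (by linarith [hd' hx]) (le_max_left _ _)

theorem eq_zero (_ : IsHalfLineTest φ) {c d x : ℝ} (h : tsupport φ ⊆ Ioo c d)
    (hx : x ≤ c ∨ d ≤ x) : φ x = 0 := by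
  refine image_eq_zero_of_notMem_tsupport fun hx' => ?_
  obtain ⟨h1, h2⟩ := h hx'
  rcases hx with hx | hx <;> linarith

theorem integrable_smul {E : Type*} [NormedAddCommGroup E] [NormedSpace ℝ E] {h : ℝ → E}
    (hφ : IsHalfLineTest φ) (hh : LocallyIntegrableOn h (Ioi 0)) :
    Integrable fun x => φ x • h x := by
  obtain ⟨c, d, hc, -, -, hs⟩ := hφ.exists_Ioo
  have h1 : IntegrableOn h (Icc c d) :=
    hh.integrableOn_compact_subset (fun x hx => lt_of_lt_of_le hc hx.1) isCompact_Icc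
  have h2 : IntegrableOn (fun x => φ x • h x) (Icc c d) :=
    h1.continuousOn_smul hφ.contDiff.continuous.continuousOn isCompact_Icc
  refine (integrableOn_iff_integrable_of_support_subset fun x hx => ?_).1 h2
  exact Ioo_subset_Icc_self (hs (subset_tsupport _ (left_ne_zero_of_smul hx)))

theorem integrable_mul (hφ : IsHalfLineTest φ) (hh : LocallyIntegrableOn h (Ioi 0)) :
    Integrable fun x => h x * φ x :=
  (hφ.integrable_smul hh).congr (.of_forall fun _ => mul_comm _ _)

theorem integral_eq_intervalIntegral {c d : ℝ} (hs : tsupport φ ⊆ Ioo c d) :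
    ∫ x, h x * φ x = ∫ x in c..d, h x * φ x :=
  (intervalIntegral.integral_eq_integral_of_support_subset fun _ hx =>
    Ioo_subset_Ioc_self (hs (subset_tsupport _ (right_ne_zero_of_mul hx)))).symm

/-- Since `g` is only locally integrable, its primitive need not be differentiable everywhere; the
integration by parts is the one for absolutely continuous functions. -/
theorem integral_primitive_mul_deriv (hφ : IsHalfLineTest φ) (hg : LocallyIntegrableOn g (Ioi 0)) :
    ∫ x, (∫ t in (1 : ℝ)..x, g t) * _root_.deriv φ x = -∫ x, g x * φ x := by
  obtain ⟨c, d, hc, hc1, hd1, hs⟩ := hφ.exists_Ioo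
  have hcd : c ≤ d := hc1.trans hd1
  have hgi : IntervalIntegrable g volume c d := by
    rw [intervalIntegrable_iff_integrableOn_Icc_of_le hcd]
    exact hg.integrableOn_compact_subset (fun x hx => lt_of_lt_of_le hc hx.1) isCompact_Icc
  have h1 : (1 : ℝ) ∈ uIcc c d := by rw [uIcc_of_le hcd]; exact ⟨hc1, hd1⟩
  rw [integral_eq_intervalIntegral (tsupport_deriv_subset.trans hs),
    integral_eq_intervalIntegral hs,
    (hgi.absolutelyContinuousOnInterval_intervalIntegral h1).integral_mul_deriv_eq_deriv_mul
      (hφ.contDiff.contDiffOn.of_le (by norm_num)).absolutelyContinuousOnInterval,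
    hφ.eq_zero hs (.inl le_rfl), hφ.eq_zero hs (.inr le_rfl), mul_zero, mul_zero, sub_zero,
    zero_sub]
  congr 1
  refine intervalIntegral.integral_congr_ae ?_
  filter_upwards [hgi.ae_hasDerivAt_integral] with x hx hx'
  rw [(hx (uIoc_subset_uIcc hx') 1 h1).deriv]

theorem exists_primitive (hφ : IsHalfLineTest φ) (h0 : ∫ x, φ x = 0) :
    ∃ Φ, IsHalfLineTest Φ ∧ _root_.deriv Φ = φ := by
  obtain ⟨c, d, hc, hc1, hd1, hs⟩ := hφ.exists_Ioo
  have hcont := hφ.contDiff.continuous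
  have hder : ∀ x, HasDerivAt (fun x => ∫ t in c..x, φ t) (φ x) x := fun x =>
    intervalIntegral.integral_hasDerivAt_right (hcont.intervalIntegrable _ _)
      (hcont.stronglyMeasurableAtFilter _ _) hcont.continuousAt
  have hd : _root_.deriv (fun x => ∫ t in c..x, φ t) = φ := funext fun x => (hder x).deriv
  have hsupp : Function.support (fun x => ∫ t in c..x, φ t) ⊆ Icc c d := by
    intro x hx
    by_contra hx'
    apply hx
    rw [mem_Icc, not_and_or, not_le, not_le] at hx'
    rcases hx' with hx' | hx'
    · refine (intervalIntegral.integral_congr (g := fun _ => 0) fun t ht => ?_).trans (by simp)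
      rw [uIcc_of_ge hx'.le] at ht
      exact hφ.eq_zero hs (.inl ht.2)
    · have e1 : ∫ t in d..x, φ t = 0 := by
        refine (intervalIntegral.integral_congr (g := fun _ => 0) fun t ht => ?_).trans (by simp)
        rw [uIcc_of_le hx'.le] at ht
        exact hφ.eq_zero hs (.inr ht.1)
      have e2 : ∫ t in c..d, φ t = 0 := by
        have := integral_eq_intervalIntegral (h := fun _ => 1) hs
        simp only [one_mul] at this
        rw [← this, h0]
      change ∫ t in c..x, φ t = 0
      rw [← intervalIntegral.integral_add_adjacent_intervals (hcont.intervalIntegrable c d)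
        (hcont.intervalIntegrable d x), e1, e2, add_zero]
  refine ⟨_, ⟨?_, HasCompactSupport.of_support_subset_isCompact isCompact_Icc hsupp,
    (closure_minimal hsupp isClosed_Icc).trans fun x hx => lt_of_lt_of_le hc hx.1⟩, hd⟩
  rw [contDiff_infty_iff_deriv, hd]
  exact ⟨fun x => (hder x).differentiableAt, hφ.contDiff⟩

theorem exists_integral_eq_one : ∃ η, IsHalfLineTest η ∧ ∫ x, η x = 1 := by
  obtain ⟨f, hs, hc, hsm, hr, h1⟩ := exists_contDiff_tsupport_subset (n := ⊤)
    (Ioi_mem_nhds (zero_lt_one (α := ℝ)))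
  have hf : IsHalfLineTest f := ⟨hsm, hc, hs⟩
  have hpos : 0 < ∫ x, f x :=
    hsm.continuous.integral_pos_of_hasCompactSupport_nonneg_nonzero hc
      (fun x => (hr (mem_range_self x)).1) (x := 1) (by simp [h1])
  refine ⟨_, hf.const_mul (∫ x, f x)⁻¹, ?_⟩
  rw [integral_const_mul, inv_mul_cancel₀ hpos.ne']

end IsHalfLineTest

theorem continuousOn_primitive_of_locallyIntegrableOn {g : ℝ → ℝ}
    (hg : LocallyIntegrableOn g (Ioi 0)) :
    ContinuousOn (fun x => ∫ t in (1 : ℝ)..x, g t) (Ioi 0) := by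
  intro x hx
  have hx0 : (0 : ℝ) < x := hx
  have hsub : uIcc (min (x / 2) 1) (max (2 * x) 1) ⊆ Ioi 0 :=
    (convex_Ioi 0).ordConnected.uIcc_subset (mem_Ioi.2 (lt_min (by linarith) one_pos))
      (mem_Ioi.2 (lt_max_of_lt_right one_pos))
  have hle : min (x / 2) 1 ≤ max (2 * x) 1 := (min_le_right _ _).trans (le_max_right _ _)
  have h := intervalIntegral.continuousOn_primitive_interval' (μ := volume)
    (b₁ := min (x / 2) 1) (b₂ := max (2 * x) 1) (a := 1) (f := g)
    (by rw [intervalIntegrable_iff_integrableOn_Icc_of_le hle, ← uIcc_of_le hle]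
        exact hg.integrableOn_compact_subset hsub isCompact_uIcc)
    (by rw [uIcc_of_le hle]; exact ⟨min_le_right _ _, le_max_right _ _⟩)
  rw [uIcc_of_le hle] at h
  refine (h.continuousAt (Icc_mem_nhds ?_ ?_)).continuousWithinAt
  · exact (min_le_left _ _).trans_lt (by linarith)
  · exact lt_of_lt_of_le (by linarith) (le_max_left _ _)

/-- A test function is the derivative of a test function once its integral vanishes. Subtracting a
multiple of a fixed `η` of integral one achieves this, and the constant is `∫ h η`. -/
theorem ae_eq_const_of_integral_mul_deriv_eq_zero {h : ℝ → ℝ} (hh : LocallyIntegrableOn h (Ioi 0))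
    (h0 : ∀ φ, IsHalfLineTest φ → ∫ x, h x * deriv φ x = 0) :
    ∃ a, ∀ᵐ x, x ∈ Ioi (0 : ℝ) → h x = a := by
  obtain ⟨η, hη, hη1⟩ := IsHalfLineTest.exists_integral_eq_one
  have hone : LocallyIntegrableOn (fun _ : ℝ => (1 : ℝ)) (Ioi 0) :=
    (locallyIntegrable_const 1).locallyIntegrableOn _
  set a := ∫ x, h x * η x with ha
  refine ⟨a, ?_⟩
  have hha : LocallyIntegrableOn (fun x => h x - a) (Ioi 0) :=
    hh.sub ((locallyIntegrable_const a).locallyIntegrableOn _)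
  have := isOpen_Ioi.ae_eq_zero_of_integral_contDiff_smul_eq_zero hha fun φ h1 h2 h3 => by
    have hφ : IsHalfLineTest φ := ⟨h1, h2, h3⟩
    have hφi : Integrable φ := by simpa using hφ.integrable_mul hone
    have hηi : Integrable η := by simpa using hη.integrable_mul hone
    obtain ⟨Φ, hΦ, hΦ'⟩ := (hφ.sub (hη.const_mul (∫ x, φ x))).exists_primitive (by
      rw [integral_sub hφi (hηi.const_mul _), integral_const_mul, hη1, mul_one, sub_self])
    have h4 := h0 Φ hΦ
    rw [hΦ'] at h4
    have h5 : (fun x => h x * (φ x - (∫ x, φ x) * η x)) =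
        fun x => h x * φ x - (∫ x, φ x) * (h x * η x) := by ext x; ring
    rw [h5, integral_sub (hφ.integrable_mul hh) ((hη.integrable_mul hh).const_mul _),
      integral_const_mul, ← ha] at h4
    have h6 : (fun x => φ x • (h x - a)) = fun x => h x * φ x - φ x * a := by
      ext x; rw [smul_eq_mul]; ring
    rw [h6, integral_sub (hφ.integrable_mul hh) (hφi.mul_const a), integral_mul_const, h4]
  filter_upwards [this] with x hx hx0
  linarith [hx hx0]

theorem ae_eq_primitive_of_integral_mul_deriv {h g : ℝ → ℝ} (hh : LocallyIntegrableOn h (Ioi 0))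
    (hg : LocallyIntegrableOn g (Ioi 0))
    (h0 : ∀ φ, IsHalfLineTest φ → ∫ x, h x * deriv φ x = -∫ x, g x * φ x) :
    ∃ a, ∀ᵐ x, x ∈ Ioi (0 : ℝ) → h x = a + ∫ t in (1 : ℝ)..x, g t := by
  have hG : LocallyIntegrableOn (fun x => ∫ t in (1 : ℝ)..x, g t) (Ioi 0) :=
    (continuousOn_primitive_of_locallyIntegrableOn hg).locallyIntegrableOn measurableSet_Ioi
  obtain ⟨a, ha⟩ := ae_eq_const_of_integral_mul_deriv_eq_zero (hh.sub hG) fun φ hφ => by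
    simp only [Pi.sub_apply, sub_mul]
    rw [integral_sub (hφ.deriv.integrable_mul hh) (hφ.deriv.integrable_mul hG), h0 φ hφ,
      hφ.integral_primitive_mul_deriv hg, sub_self]
  refine ⟨a, ?_⟩
  filter_upwards [ha] with x hx hx0
  have := hx hx0
  rw [Pi.sub_apply] at this
  linarith

/-- A function whose second distributional derivative is `g` is a second primitive of `g`. -/
theorem ae_eq_second_primitive {u g : ℝ → ℝ} (hu : LocallyIntegrableOn u (Ioi 0))
    (hg : LocallyIntegrableOn g (Ioi 0))
    (h0 : ∀ φ, IsHalfLineTest φ → ∫ x, u x * deriv (deriv φ) x = ∫ x, g x * φ x) :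
    ∃ a b, ∀ᵐ x, x ∈ Ioi (0 : ℝ) → u x = a + ∫ t in (1 : ℝ)..x, (b + ∫ s in (1 : ℝ)..t, g s) := by
  obtain ⟨η, hη, hη1⟩ := IsHalfLineTest.exists_integral_eq_one
  have hone : LocallyIntegrableOn (fun _ : ℝ => (1 : ℝ)) (Ioi 0) :=
    (locallyIntegrable_const 1).locallyIntegrableOn _
  have hG : LocallyIntegrableOn (fun x => ∫ t in (1 : ℝ)..x, g t) (Ioi 0) :=
    (continuousOn_primitive_of_locallyIntegrableOn hg).locallyIntegrableOn measurableSet_Ioi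
  -- Testing with a primitive of `φ - (∫ φ) η` leaves a multiple of `∫ φ`; `b` collects its
  -- coefficient and is the integration constant of the first derivative.
  set b := -(∫ x, u x * deriv η x) - ∫ x, (∫ t in (1 : ℝ)..x, g t) * η x with hb
  have hGb : LocallyIntegrableOn (fun x => b + ∫ t in (1 : ℝ)..x, g t) (Ioi 0) :=
    ((locallyIntegrable_const b).locallyIntegrableOn _).add hG
  obtain ⟨a, ha⟩ := ae_eq_primitive_of_integral_mul_deriv hu hGb fun φ hφ => by
    have hφi : Integrable φ := by simpa using hφ.integrable_mul hone
    have hηi : Integrable η := by simpa using hη.integrable_mul hone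
    obtain ⟨Φ, hΦ, hΦ'⟩ := (hφ.sub (hη.const_mul (∫ x, φ x))).exists_primitive (by
      rw [integral_sub hφi (hηi.const_mul _), integral_const_mul, hη1, mul_one, sub_self])
    have h4 := h0 Φ hΦ
    rw [← neg_neg (∫ x, g x * Φ x), ← hΦ.integral_primitive_mul_deriv hg, hΦ'] at h4
    have h5 : deriv (fun x => φ x - (∫ x, φ x) * η x) =
        fun x => deriv φ x - (∫ x, φ x) * deriv η x := funext fun x =>
      ((hφ.differentiable x).hasDerivAt.sub ((hη.differentiable x).hasDerivAt.const_mul _)).deriv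
    have h6 : (fun x => u x * (deriv φ x - (∫ x, φ x) * deriv η x)) =
        fun x => u x * deriv φ x - (∫ x, φ x) * (u x * deriv η x) := by ext x; ring
    have h7 : (fun x => (∫ t in (1 : ℝ)..x, g t) * (φ x - (∫ x, φ x) * η x)) = fun x =>
        (∫ t in (1 : ℝ)..x, g t) * φ x - (∫ x, φ x) * ((∫ t in (1 : ℝ)..x, g t) * η x) := by
      ext x; ring
    rw [h5, h6, h7, integral_sub (hφ.deriv.integrable_mul hu)
      ((hη.deriv.integrable_mul hu).const_mul _), integral_sub (hφ.integrable_mul hG)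
      ((hη.integrable_mul hG).const_mul _), integral_const_mul, integral_const_mul] at h4
    have h8 : (fun x => (b + ∫ t in (1 : ℝ)..x, g t) * φ x) =
        fun x => b * φ x + (∫ t in (1 : ℝ)..x, g t) * φ x := by ext x; ring
    rw [h8, integral_add (hφi.const_mul b) (hφ.integrable_mul hG), integral_const_mul, hb]
    linarith
  exact ⟨a, b, ha⟩

/-! ## Deficiency subspaces of the Schroedinger operator -/

/-- A real test function as an element of `𝓓(halfLine, ℂ)`. -/
noncomputable def IsHalfLineTest.toTestFunction {φ : ℝ → ℝ} (hφ : IsHalfLineTest φ) :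
    𝓓(halfLine, ℂ) where
  toFun x := (φ x : ℂ)
  contDiff' := Complex.ofRealCLM.contDiff.comp hφ.contDiff
  hasCompactSupport' := hφ.hasCompactSupport.comp_left (g := ((↑) : ℝ → ℂ)) Complex.ofReal_zero
  tsupport_subset' := (closure_mono fun x hx => by
    simpa using hx : tsupport (fun x => (φ x : ℂ)) ⊆ tsupport φ).trans hφ.tsupport_subset

theorem IsHalfLineTest.toTestFunction_apply {φ : ℝ → ℝ} (hφ : IsHalfLineTest φ) (x : ℝ) :
    hφ.toTestFunction x = (φ x : ℂ) := rfl

theorem schrodingerExpr_toTestFunction {φ : ℝ → ℝ} (hφ : IsHalfLineTest φ)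
    (V : ℝ → ℝ) (x : ℝ) : schrodingerExpr V hφ.toTestFunction x =
      ((-deriv (deriv φ) x + V x * φ x : ℝ) : ℂ) := by
  have h1 : deriv (fun x => (φ x : ℂ)) = fun x => ((deriv φ x : ℝ) : ℂ) := funext fun x =>
    (hφ.differentiable x).hasDerivAt.ofReal_comp.deriv
  have h2 : deriv (fun x => ((deriv φ x : ℝ) : ℂ)) x = ((deriv (deriv φ) x : ℝ) : ℂ) :=
    (hφ.deriv.differentiable x).hasDerivAt.ofReal_comp.deriv
  change -deriv (deriv (fun x => (φ x : ℂ))) x + (V x : ℂ) * (φ x : ℂ) = _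
  rw [h1, h2]
  push_cast
  ring

theorem testFunction_eq_zero (φ : 𝓓(halfLine, ℂ)) {x : ℝ} (hx : x ∉ Ioi (0 : ℝ)) : φ x = 0 :=
  image_eq_zero_of_notMem_tsupport fun h => hx (φ.tsupport_subset h)

theorem inner_testToL2_left (φ : 𝓓(halfLine, ℂ)) (u : L2HalfLine) :
    ⟪testToL2 φ, u⟫_ℂ = ∫ x in Ioi (0 : ℝ), starRingEnd ℂ (φ x) * u x := by
  rw [L2.inner_def]
  refine integral_congr_ae ?_
  filter_upwards [(memLp_testFunction φ).coeFn_toLp] with x hx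
  change ⟪((memLp_testFunction φ).toLp φ : ℝ → ℂ) x, u x⟫_ℂ = _
  rw [hx, RCLike.inner_apply, mul_comm]

variable {V : ℝ → ℝ} (hV : ContinuousOn V (Ioi 0))

theorem inner_schrodingerMap_left (φ : 𝓓(halfLine, ℂ)) (u : L2HalfLine) :
    ⟪schrodingerMap V hV φ, u⟫_ℂ =
      ∫ x in Ioi (0 : ℝ), starRingEnd ℂ (schrodingerExpr V φ x) * u x := by
  rw [L2.inner_def]
  refine integral_congr_ae ?_
  filter_upwards [(memLp_schrodingerExpr hV φ).coeFn_toLp] with x hx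
  change ⟪((memLp_schrodingerExpr hV φ).toLp _ : ℝ → ℂ) x, u x⟫_ℂ = _
  rw [hx, RCLike.inner_apply, mul_comm]

theorem schrodingerOp_apply {x : (schrodingerOp V hV).domain} {φ : 𝓓(halfLine, ℂ)}
    (h : testToL2 φ = x) : schrodingerOp V hV x = schrodingerMap V hV φ := by
  change schrodingerMap V hV ((LinearEquiv.ofInjective testToL2 testToL2_injective).symm x) = _
  congr 1
  exact testToL2_injective ((LinearEquiv.ofInjective_symm_apply testToL2 x).trans h.symm)

theorem mem_graph_schrodingerOp (φ : 𝓓(halfLine, ℂ)) :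
    (testToL2 φ, schrodingerMap V hV φ) ∈ (schrodingerOp V hV).graph := by
  rw [LinearPMap.mem_graph_iff]
  exact ⟨⟨testToL2 φ, LinearMap.mem_range_self _ _⟩, rfl, schrodingerOp_apply hV rfl⟩

theorem locallyIntegrableOn_L2 (u : L2HalfLine) : LocallyIntegrableOn u (Ioi 0) :=
  locallyIntegrableOn_of_locallyIntegrable_restrict ((Lp.memLp u).locallyIntegrable one_le_two)

theorem dense_schrodingerOp_domain : Dense ((schrodingerOp V hV).domain : Set L2HalfLine) := by
  change Dense ((LinearMap.range testToL2 : Submodule ℂ L2HalfLine) : Set L2HalfLine)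
  rw [Submodule.dense_iff_topologicalClosure_eq_top,
    Submodule.topologicalClosure_eq_top_iff, Submodule.eq_bot_iff]
  intro u hu
  have h := isOpen_Ioi.ae_eq_zero_of_integral_contDiff_smul_eq_zero (locallyIntegrableOn_L2 u)
    fun g h1 h2 h3 => by
      have hg : IsHalfLineTest g := ⟨h1, h2, h3⟩
      have h := (Submodule.mem_orthogonal _ _).1 hu _ (LinearMap.mem_range_self testToL2
        hg.toTestFunction)
      rw [inner_testToL2_left, setIntegral_eq_integral_of_forall_compl_eq_zero fun x hx => by
        rw [testFunction_eq_zero _ hx, map_zero, zero_mul]] at h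
      rw [← h]
      refine integral_congr_ae (.of_forall fun x => ?_)
      simp [hg.toTestFunction_apply]
  rw [Lp.eq_zero_iff_ae_eq_zero]
  filter_upwards [ae_restrict_of_ae h, ae_restrict_mem measurableSet_Ioi] with x hx hx0
  exact hx hx0

theorem isFormalAdjoint_schrodingerOp :
    (schrodingerOp V hV).IsFormalAdjoint (schrodingerOp V hV) := by
  intro x y
  obtain ⟨φ, hφ⟩ := x.2
  obtain ⟨χ, hχ⟩ := y.2
  rw [schrodingerOp_apply hV hφ, schrodingerOp_apply hV hχ, ← hφ, ← hχ]
  have hd : ∀ χ : 𝓓(halfLine, ℂ), Differentiable ℝ (χ : ℝ → ℂ) := fun χ =>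
    χ.contDiff.differentiable (by simp)
  have hd1 : ∀ χ : 𝓓(halfLine, ℂ), ContDiff ℝ ∞ (deriv (χ : ℝ → ℂ)) := fun χ =>
    (contDiff_infty_iff_deriv.1 χ.contDiff).2
  have hdd : ∀ χ : 𝓓(halfLine, ℂ), Differentiable ℝ (deriv (χ : ℝ → ℂ)) := fun χ =>
    (hd1 χ).differentiable (by simp)
  have hc2 : ∀ χ : 𝓓(halfLine, ℂ), Continuous (deriv (deriv (χ : ℝ → ℂ))) := fun χ =>
    (contDiff_infty_iff_deriv.1 (hd1 χ)).2.continuous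
  have hcs : HasCompactSupport fun x => starRingEnd ℂ (φ x) :=
    φ.hasCompactSupport.comp_left (g := starRingEnd ℂ) (map_zero _)
  have hcs1 : HasCompactSupport fun x => starRingEnd ℂ (deriv φ x) :=
    φ.hasCompactSupport.deriv.comp_left (g := starRingEnd ℂ) (map_zero _)
  have hcs2 : HasCompactSupport fun x => starRingEnd ℂ (deriv (deriv φ) x) :=
    φ.hasCompactSupport.deriv.deriv.comp_left (g := starRingEnd ℂ) (map_zero _)
  have hk0 : Continuous fun x => starRingEnd ℂ (φ x) := Complex.continuous_conj.comp φ.continuous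
  have hk1 : Continuous fun x => starRingEnd ℂ (deriv φ x) :=
    Complex.continuous_conj.comp (hdd φ).continuous
  have hk2 : Continuous fun x => starRingEnd ℂ (deriv (deriv φ) x) :=
    Complex.continuous_conj.comp (hc2 φ)
  have i1 : ∫ x, starRingEnd ℂ (φ x) * deriv (deriv χ) x =
      -∫ x, starRingEnd ℂ (deriv φ x) * deriv χ x :=
    integral_mul_deriv_eq_deriv_mul_of_integrable (fun x _ => ((hd φ) x).hasDerivAt.star)
      (fun x _ => (hdd χ x).hasDerivAt)
      ((hk0.mul (hc2 χ)).integrable_of_hasCompactSupport hcs.mul_right)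
      ((hk1.mul (hdd χ).continuous).integrable_of_hasCompactSupport hcs1.mul_right)
      ((hk0.mul (hdd χ).continuous).integrable_of_hasCompactSupport hcs.mul_right)
  have i2 : ∫ x, starRingEnd ℂ (deriv φ x) * deriv χ x =
      -∫ x, starRingEnd ℂ (deriv (deriv φ) x) * χ x :=
    integral_mul_deriv_eq_deriv_mul_of_integrable (fun x _ => ((hdd φ) x).hasDerivAt.star)
      (fun x _ => (hd χ x).hasDerivAt)
      ((hk1.mul (hdd χ).continuous).integrable_of_hasCompactSupport hcs1.mul_right)
      ((hk2.mul χ.continuous).integrable_of_hasCompactSupport hcs2.mul_right)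
      ((hk1.mul χ.continuous).integrable_of_hasCompactSupport hcs1.mul_right)
  rw [inner_schrodingerMap_left, inner_testToL2_left]
  have e1 : ∫ x in Ioi (0 : ℝ), starRingEnd ℂ (schrodingerExpr V φ x) * testToL2 χ x =
      ∫ x in Ioi (0 : ℝ), starRingEnd ℂ (schrodingerExpr V φ x) * χ x := by
    refine integral_congr_ae ?_
    filter_upwards [(memLp_testFunction χ).coeFn_toLp] with x hx
    rw [← hx]; rfl
  have e2 : ∫ x in Ioi (0 : ℝ), starRingEnd ℂ (φ x) * schrodingerMap V hV χ x =
      ∫ x in Ioi (0 : ℝ), starRingEnd ℂ (φ x) * schrodingerExpr V χ x := by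
    refine integral_congr_ae ?_
    filter_upwards [(memLp_schrodingerExpr hV χ).coeFn_toLp] with x hx
    rw [← hx]; rfl
  rw [e1, e2, ← sub_eq_zero, ← integral_sub]
  · have e3 : ∀ x, starRingEnd ℂ (schrodingerExpr V φ x) * χ x -
        starRingEnd ℂ (φ x) * schrodingerExpr V χ x =
        starRingEnd ℂ (φ x) * deriv (deriv χ) x - starRingEnd ℂ (deriv (deriv φ) x) * χ x := by
      intro x
      simp only [schrodingerExpr, map_add, map_neg, map_mul, Complex.conj_ofReal]
      ring
    have j1 : Integrable fun x => starRingEnd ℂ (φ x) * deriv (deriv χ) x :=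
      (hk0.mul (hc2 χ)).integrable_of_hasCompactSupport hcs.mul_right
    have j2 : Integrable fun x => starRingEnd ℂ (deriv (deriv φ) x) * χ x :=
      (hk2.mul χ.continuous).integrable_of_hasCompactSupport hcs2.mul_right
    simp only [e3]
    rw [setIntegral_eq_integral_of_forall_compl_eq_zero fun x hx => by
        rw [testFunction_eq_zero _ hx, testFunction_eq_zero _ hx]; simp,
      integral_sub j1 j2, i1, i2]
    ring
  · exact ((memLp_schrodingerExpr hV φ).star).integrable_mul (memLp_testFunction χ)
  · exact ((memLp_testFunction φ).star).integrable_mul (memLp_schrodingerExpr hV χ)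

/-- Elements of the deficiency subspaces are classical solutions. -/
theorem exists_solvesOn_of_mem_graph_adjoint {z : ℂ} {u : L2HalfLine}
    (hu : (u, z • u) ∈ (schrodingerOp V hV).adjoint.graph) :
    ∃ ψ ψ', SolvesOn V z ψ ψ' (Ioi 0) ∧ u =ᵐ[volume.restrict (Ioi 0)] ψ := by
  rw [mem_graph_adjoint_iff (dense_schrodingerOp_domain hV)] at hu
  have hul := locallyIntegrableOn_L2 u
  have hVz : ContinuousOn (fun x => (V x : ℂ) - z) (Ioi 0) :=
    (Complex.continuous_ofReal.comp_continuousOn hV).sub continuousOn_const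
  have hgl : LocallyIntegrableOn (fun x => ((V x : ℂ) - z) * u x) (Ioi 0) :=
    hul.continuousOn_mul hVz isOpen_Ioi.isLocallyClosed
  have hVu : LocallyIntegrableOn (fun x => (V x : ℂ) * u x) (Ioi 0) :=
    hul.continuousOn_mul (Complex.continuous_ofReal.comp_continuousOn hV) isOpen_Ioi.isLocallyClosed
  have hzu : LocallyIntegrableOn (fun x => z * u x) (Ioi 0) :=
    hul.continuousOn_mul continuousOn_const isOpen_Ioi.isLocallyClosed
  have hweak : ∀ φ, IsHalfLineTest φ →
      ∫ x, deriv (deriv φ) x • u x = ∫ x, φ x • (((V x : ℂ) - z) * u x) := by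
    intro φ hφ
    have h := hu _ _ (mem_graph_schrodingerOp hV hφ.toTestFunction)
    have h0 : ∀ {φ : ℝ → ℝ}, IsHalfLineTest φ → ∀ x ∉ Ioi (0 : ℝ), φ x = 0 := fun hφ x hx =>
      image_eq_zero_of_notMem_tsupport fun h => hx (hφ.tsupport_subset h)
    have e1 : ∫ x in Ioi (0 : ℝ), starRingEnd ℂ (schrodingerExpr V hφ.toTestFunction x) * u x =
        ∫ x, (φ x • ((V x : ℂ) * u x) - deriv (deriv φ) x • u x) := by
      refine Eq.trans ?_ (setIntegral_eq_integral_of_forall_compl_eq_zero (s := Ioi 0)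
        fun x hx => by rw [h0 hφ x hx, h0 hφ.deriv.deriv x hx, zero_smul, zero_smul, sub_zero])
      refine integral_congr_ae (.of_forall fun x => ?_)
      dsimp only
      rw [schrodingerExpr_toTestFunction, Complex.conj_ofReal, Complex.real_smul,
        Complex.real_smul]
      push_cast
      ring
    have e2 : ∫ x in Ioi (0 : ℝ), starRingEnd ℂ (hφ.toTestFunction x) * (z • u : L2HalfLine) x =
        ∫ x, φ x • (z * u x) := by
      refine Eq.trans ?_ (setIntegral_eq_integral_of_forall_compl_eq_zero (s := Ioi 0)
        fun x hx => by rw [h0 hφ x hx, zero_smul])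
      refine integral_congr_ae ?_
      filter_upwards [Lp.coeFn_smul z u] with x hx
      rw [hx, hφ.toTestFunction_apply, Complex.conj_ofReal, Complex.real_smul, Pi.smul_apply,
        smul_eq_mul]
    rw [inner_schrodingerMap_left, inner_testToL2_left, e1, e2,
      integral_sub (hφ.integrable_smul hVu) (hφ.deriv.deriv.integrable_smul hul)] at h
    have e3 : (fun x => φ x • (((V x : ℂ) - z) * u x)) =
        fun x => φ x • ((V x : ℂ) * u x) - φ x • (z * u x) := by
      ext x; rw [sub_mul, smul_sub]
    rw [e3, integral_sub (hφ.integrable_smul hVu) (hφ.integrable_smul hzu), ← h]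
    ring
  -- The second-primitive lemma is real-valued, so it is applied to the real and imaginary parts.
  have hL : ∀ L : ℂ →L[ℝ] ℝ, ∃ a b : ℝ, ∀ᵐ x, x ∈ Ioi (0 : ℝ) → L (u x) =
      a + ∫ t in (1 : ℝ)..x, (b + ∫ s in (1 : ℝ)..t, L (((V s : ℂ) - z) * u s)) := by
    intro L
    have hLi : ∀ {f : ℝ → ℂ}, LocallyIntegrableOn f (Ioi 0) →
        LocallyIntegrableOn (fun x => L (f x)) (Ioi 0) := fun hf x hx => by
      obtain ⟨s, hs, h⟩ := hf x hx
      exact ⟨s, hs, L.integrable_comp h⟩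
    refine ae_eq_second_primitive (hLi hul) (hLi hgl) fun φ hφ => ?_
    have h := congrArg L (hweak φ hφ)
    rw [← L.integral_comp_comm (hφ.deriv.deriv.integrable_smul hul),
      ← L.integral_comp_comm (hφ.integrable_smul hgl)] at h
    simpa only [map_smul, smul_eq_mul, mul_comm] using h
  obtain ⟨a₁, b₁, h₁⟩ := hL Complex.reCLM
  obtain ⟨a₂, b₂, h₂⟩ := hL Complex.imCLM
  have hprim : ∀ L : ℂ →L[ℝ] ℝ, ContinuousOn
      (fun t => ∫ s in (1 : ℝ)..t, L (((V s : ℂ) - z) * u s)) (Ioi 0) := fun L =>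
    continuousOn_primitive_of_locallyIntegrableOn fun x hx => by
      obtain ⟨s, hs, h⟩ := hgl x hx
      exact ⟨s, hs, L.integrable_comp h⟩
  have hd : ∀ (L : ℂ →L[ℝ] ℝ) (a b : ℝ), ∀ x > 0, HasDerivAt
      (fun x => a + ∫ t in (1 : ℝ)..x, (b + ∫ s in (1 : ℝ)..t, L (((V s : ℂ) - z) * u s)))
      (b + ∫ s in (1 : ℝ)..x, L (((V s : ℂ) - z) * u s)) x := fun L a b x hx =>
    (hasDerivAt_integral_one (continuousOn_const.add (hprim L)) hx).const_add a
  let ψ : ℝ → ℂ := fun x =>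
    ((a₁ + ∫ t in (1 : ℝ)..x,
      (b₁ + ∫ s in (1 : ℝ)..t, Complex.reCLM (((V s : ℂ) - z) * u s)) : ℝ) : ℂ) +
    ((a₂ + ∫ t in (1 : ℝ)..x,
      (b₂ + ∫ s in (1 : ℝ)..t, Complex.imCLM (((V s : ℂ) - z) * u s)) : ℝ) : ℂ) * Complex.I
  let ψ' : ℝ → ℂ := fun x =>
    ((b₁ + ∫ s in (1 : ℝ)..x, Complex.reCLM (((V s : ℂ) - z) * u s) : ℝ) : ℂ) +
    ((b₂ + ∫ s in (1 : ℝ)..x, Complex.imCLM (((V s : ℂ) - z) * u s) : ℝ) : ℂ) * Complex.I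
  have hψ : ∀ x > 0, HasDerivAt ψ (ψ' x) x := fun x hx =>
    (hd Complex.reCLM a₁ b₁ x hx).ofReal_comp.add
      ((hd Complex.imCLM a₂ b₂ x hx).ofReal_comp.mul_const Complex.I)
  have hae : ∀ᵐ x, x ∈ Ioi (0 : ℝ) → u x = ψ x := by
    filter_upwards [h₁, h₂] with x hx₁ hx₂ hx
    simp only [ψ]
    rw [← hx₁ hx, ← hx₂ hx]
    exact (Complex.re_add_im _).symm
  have hψc : ContinuousOn (fun x => ((V x : ℂ) - z) * ψ x) (Ioi 0) :=
    hVz.mul fun x hx => (hψ x hx).continuousAt.continuousWithinAt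
  -- Bootstrap: under the integral `u` may be replaced by its continuous representative `ψ`, so `ψ'`
  -- is differentiable at every point.
  have hd2 : ∀ (L : ℂ →L[ℝ] ℝ) (b : ℝ), ∀ x > 0, HasDerivAt
      (fun x => b + ∫ s in (1 : ℝ)..x, L (((V s : ℂ) - z) * u s))
      (L (((V x : ℂ) - z) * ψ x)) x := fun L b x hx => by
    refine HasDerivAt.const_add b ((hasDerivAt_integral_one
      (L.continuous.comp_continuousOn hψc) hx).congr_of_eventuallyEq ?_)
    filter_upwards [Ioi_mem_nhds hx] with y hy
    refine intervalIntegral.integral_congr_ae ?_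
    filter_upwards [hae] with s hs hsy
    have : s ∈ Ioi (0 : ℝ) := (convex_Ioi 0).ordConnected.uIcc_subset (mem_Ioi.2 one_pos) hy
      (uIoc_subset_uIcc hsy)
    simp only [Function.comp_apply, hs this]
  refine ⟨ψ, ψ', fun x hx => ⟨hψ x hx, ?_⟩, ?_⟩
  · convert! (hd2 Complex.reCLM b₁ x hx).ofReal_comp.add
      ((hd2 Complex.imCLM b₂ x hx).ofReal_comp.mul_const Complex.I) using 1
    exact (Complex.re_add_im _).symm
  · filter_upwards [ae_restrict_of_ae hae, ae_restrict_mem measurableSet_Ioi] with x hx hx0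
    exact hx hx0

/-! ## Limit point endpoints and deficiency subspaces -/

section

variable {V : ℝ → ℝ} {z : ℂ} {ψ ψ' q q' : ℝ → ℂ}

theorem exists_wronskian_eq_one (hV : ContinuousOn V (Ioi 0)) (z : ℂ) :
    ∃ ψ₁ ψ₁' ψ₂ ψ₂', SolvesOn V z ψ₁ ψ₁' (Ioi 0) ∧ SolvesOn V z ψ₂ ψ₂' (Ioi 0) ∧
      ∀ x > 0, wronskian ψ₁ ψ₁' ψ₂ ψ₂' x = 1 := by
  obtain ⟨ψ₁, ψ₁', a₁, b₁, h₁⟩ := exists_solution hV z 0 1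
  obtain ⟨ψ₂, ψ₂', a₂, b₂, h₂⟩ := exists_solution hV z 1 0
  have s₁ : SolvesOn V z ψ₁ ψ₁' (Ioi 0) := h₁
  have s₂ : SolvesOn V z ψ₂ ψ₂' (Ioi 0) := h₂
  refine ⟨ψ₁, ψ₁', ψ₂, ψ₂', s₁, s₂, fun x hx => ?_⟩
  have hd : ∀ x ∈ Ioi (0 : ℝ), HasDerivAt (wronskian ψ₁ ψ₁' ψ₂ ψ₂') 0 x := fun x hx => by
    simpa using s₁.hasDerivAt_wronskian s₂ hx
  have h := isOpen_Ioi.is_const_of_deriv_eq_zero (convex_Ioi (0 : ℝ)).isPreconnected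
    (fun x hx => (hd x hx).differentiableAt.differentiableWithinAt)
    (fun x hx => (hd x hx).deriv) hx (mem_Ioi.2 one_pos)
  rw [h, wronskian, a₁, b₁, a₂, b₂]
  ring

/-- The limit point case at infinity follows from one solution that is not square integrable. -/
theorem SolvesOn.limitPointAtInfinity (hV : ContinuousOn V (Ioi 0)) (hq : SolvesOn V z q q' (Ioi 0))
    (hq2 : ¬ MemLp q 2 (volume.restrict (Ioi (1 : ℝ)))) : LimitPointAtInfinity V := by
  rintro ⟨z', hz⟩
  obtain ⟨ψ₁, ψ₁', ψ₂, ψ₂', h₁, h₂, hw⟩ := exists_wronskian_eq_one hV z'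
  refine SolvesOn.not_wronskian_bounded_below_atTop le_rfl one_pos hq h₁ h₂ hq2
    (hz _ h₁.isSolution) (hz _ h₂.isSolution) fun x hx => ?_
  rw [hw x (one_pos.trans_le hx), norm_one]

/-- The limit point case at zero follows from one solution that is not square integrable. -/
theorem SolvesOn.limitPointAtZero (hV : ContinuousOn V (Ioi 0)) (hq : SolvesOn V z q q' (Ioi 0))
    (hq2 : ¬ MemLp q 2 (volume.restrict (Ioo (0 : ℝ) 1))) : LimitPointAtZero V := by
  rintro ⟨z', hz⟩
  obtain ⟨ψ₁, ψ₁', ψ₂, ψ₂', h₁, h₂, hw⟩ := exists_wronskian_eq_one hV z'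
  refine SolvesOn.not_wronskian_bounded_below_zero one_pos le_rfl one_pos hq h₁ h₂ hq2
    (hz _ h₁.isSolution) (hz _ h₂.isSolution) fun x hx _ => ?_
  rw [hw x hx, norm_one]

/-- At a non-real energy there is no square integrable solution if both endpoints are in the limit
point case. -/
theorem SolvesOn.eq_zero_of_memLp {z₀ z₁ : ℂ} {q₀ q₀' q₁ q₁' : ℝ → ℂ}
    (hq₀ : SolvesOn V z₀ q₀ q₀' (Ioi 0)) (hq₀2 : ¬ MemLp q₀ 2 (volume.restrict (Ioo (0 : ℝ) 1)))
    (hq₁ : SolvesOn V z₁ q₁ q₁' (Ioi 0)) (hq₁2 : ¬ MemLp q₁ 2 (volume.restrict (Ioi (1 : ℝ))))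
    (hz : z.im ≠ 0) (hψ : SolvesOn V z ψ ψ' (Ioi 0))
    (hm : MemLp ψ 2 (volume.restrict (Ioi (0 : ℝ)))) {x : ℝ} (hx : 0 < x) : ψ x = 0 := by
  have hmc := hm.star
  have hsub1 : Ioi (1 : ℝ) ⊆ Ioi 0 := Ioi_subset_Ioi zero_le_one
  have hsub0 : Ioo (0 : ℝ) 1 ⊆ Ioi 0 := Ioo_subset_Ioi_self
  set W : ℝ → ℂ := wronskian ψ ψ' (fun x => starRingEnd ℂ (ψ x)) (fun x => starRingEnd ℂ (ψ' x))
  -- The Wronskian of `ψ` with its conjugate has derivative `-2 i (Im z) |ψ|²`; this normalization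
  -- gives `F' = 2 |ψ|²` whatever the sign of `Im z`. A negative value of `F` persists towards zero
  -- and a positive one towards infinity, and each contradicts the limit point property there.
  set F : ℝ → ℝ := fun x => -(W x).im / z.im
  have hF : ∀ x ∈ Ioi (0 : ℝ), HasDerivAt F (2 * Complex.normSq (ψ x)) x := fun x hx => by
    have h := (Complex.imCLM.hasFDerivAt.comp_hasDerivAt x
      (hψ.hasDerivAt_wronskian hψ.conj hx)).neg.div_const z.im
    convert! h using 1
    rw [Complex.mul_conj, Complex.imCLM_apply, Complex.im_mul_ofReal]
    simp only [Complex.sub_im, Complex.conj_im]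
    field_simp
    ring
  have hmono : MonotoneOn F (Ioi 0) := monotoneOn_of_deriv_nonneg (convex_Ioi 0)
    (fun x hx => (hF x hx).continuousAt.continuousWithinAt)
    (fun x hx => (hF x (interior_subset hx)).differentiableAt.differentiableWithinAt)
    fun x hx => by
      rw [(hF x (interior_subset hx)).deriv]
      exact mul_nonneg zero_le_two (Complex.normSq_nonneg _)
  have hW : ∀ x, |z.im| * |F x| ≤ ‖W x‖ := fun x => by
    rw [← abs_mul, mul_div_cancel₀ _ hz, abs_neg]
    exact Complex.abs_im_le_norm _
  have hz' : 0 < |z.im| := abs_pos.2 hz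
  have hF0 : ∀ x ∈ Ioi (0 : ℝ), F x = 0 := fun x hx => by
    have hx0 : (0 : ℝ) < x := hx
    rcases lt_trichotomy (F x) 0 with h | h | h
    · refine (SolvesOn.not_wronskian_bounded_below_zero (lt_min hx0 one_pos) (min_le_right x 1)
        (mul_pos hz' (abs_pos.2 h.ne)) hq₀ hψ hψ.conj hq₀2
        (hm.mono_measure (Measure.restrict_mono_set _ hsub0))
        (hmc.mono_measure (Measure.restrict_mono_set _ hsub0)) fun y hy hyx => ?_).elim
      refine (mul_le_mul_of_nonneg_left ?_ hz'.le).trans (hW y)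
      have := hmono hy hx (hyx.trans (min_le_left _ _))
      rw [abs_of_neg h, abs_of_neg (this.trans_lt h)]
      linarith
    · exact h
    · refine (SolvesOn.not_wronskian_bounded_below_atTop (le_max_right x 1)
        (mul_pos hz' (abs_pos.2 h.ne')) hq₁ hψ hψ.conj hq₁2
        (hm.mono_measure (Measure.restrict_mono_set _ hsub1))
        (hmc.mono_measure (Measure.restrict_mono_set _ hsub1)) fun y hy => ?_).elim
      refine (mul_le_mul_of_nonneg_left ?_ hz'.le).trans (hW y)
      have := hmono hx (hx0.trans_le ((le_max_left _ _).trans hy)) ((le_max_left _ _).trans hy)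
      rwa [abs_of_pos h, abs_of_pos (h.trans_le this)]
  have h1 : HasDerivAt F 0 x := (hasDerivAt_const x (0 : ℝ)).congr_of_eventuallyEq
    (eventually_of_mem (Ioi_mem_nhds hx) hF0)
  have h2 := (hF x hx).unique h1
  exact Complex.normSq_eq_zero.1 (by linarith)

theorem eq_zero_of_mem_graph_adjoint (hV : ContinuousOn V (Ioi 0)) {z₀ z₁ : ℂ}
    {q₀ q₀' q₁ q₁' : ℝ → ℂ}
    (hq₀ : SolvesOn V z₀ q₀ q₀' (Ioi 0)) (hq₀2 : ¬ MemLp q₀ 2 (volume.restrict (Ioo (0 : ℝ) 1)))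
    (hq₁ : SolvesOn V z₁ q₁ q₁' (Ioi 0)) (hq₁2 : ¬ MemLp q₁ 2 (volume.restrict (Ioi (1 : ℝ))))
    (hz : z.im ≠ 0) {u : L2HalfLine} (hu : (u, z • u) ∈ (schrodingerOp V hV).adjoint.graph) :
    u = 0 := by
  obtain ⟨ψ, ψ', hψ, hae⟩ := exists_solvesOn_of_mem_graph_adjoint hV hu
  have hm : MemLp ψ 2 (volume.restrict (Ioi (0 : ℝ))) := (Lp.memLp u).ae_eq hae
  rw [Lp.eq_zero_iff_ae_eq_zero]
  filter_upwards [hae, ae_restrict_mem measurableSet_Ioi] with x hx hx0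
  rw [hx, hq₀.eq_zero_of_memLp hq₀2 hq₁ hq₁2 hz hψ hm hx0, Pi.zero_apply]

end

end KSDirac

/-! ### The main theorem. -/

theorem mainTheorem2 (w M : ℝ) (hw : 0 < w) (hM : 0 < M) (hnaked : w * M ^ 2 < 1 / 2) :
    -- there is no horizon, and the tortoise coordinate maps `(0,∞)` onto `(0,∞)`
    (∀ r > 0, 0 < KSDirac.ksF w M r) ∧
    Set.BijOn (KSDirac.tortoise w M) (Set.Ioi 0) (Set.Ioi 0) ∧
    ∀ lam ε : ℝ, (ε = 1 ∨ ε = -1) →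
      -- the Chandrasekhar-Dirac equations reduce to `(d²/dx² + k²) Z = V Z` for `Z = R₁ + ε R₂`
      (∀ (k m : ℝ) (R₁ R₂ S₁ S₂ : ℝ → ℂ),
        DifferentiableOn ℝ R₁ (Set.Ioi 0) → DifferentiableOn ℝ R₂ (Set.Ioi 0) →
        KSDirac.IsAngularPair m lam S₁ S₂ →
        KSDirac.IsCDMode (KSDirac.ksF w M) k m R₁ R₂ S₁ S₂ →
        KSDirac.IsSolution (KSDirac.diracPotential w M lam ε) ((k : ℂ) ^ 2)
          (fun x => R₁ (KSDirac.radius w M x) + ε * R₂ (KSDirac.radius w M x))) ∧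
      KSDirac.LimitPointAtInfinity (KSDirac.diracPotential w M lam ε) ∧
      ∃ hV : ContinuousOn (KSDirac.diracPotential w M lam ε) (Set.Ioi 0),
        3 / 4 ≤ lam ^ 2 - ε * lam →
          KSDirac.LimitPointAtZero (KSDirac.diracPotential w M lam ε) ∧
          (∀ z : ℂ, z.im ≠ 0 → KSDirac.deficiencyIndex
            (KSDirac.schrodingerOp (KSDirac.diracPotential w M lam ε) hV) z = 0) ∧
          KSDirac.IsEssentiallySelfAdjoint
            (KSDirac.schrodingerOp (KSDirac.diracPotential w M lam ε) hV) ∧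
          KSDirac.IsQuantumRegular
            (KSDirac.schrodingerOp (KSDirac.diracPotential w M lam ε) hV) := by
  refine ⟨fun r _ => KSDirac.ksF_pos hw hnaked r, KSDirac.bijOn_tortoise hw hM hnaked,
    fun lam ε hε => ?_⟩
  have hε2 : ε ^ 2 = 1 := by rcases hε with rfl | rfl <;> norm_num
  -- Both signs are treated at once with `s = ε λ`, since `s² = λ²`.
  have hs : (ε * lam) ^ 2 = lam ^ 2 := by rw [mul_pow, hε2, one_mul]
  have hVs : ∀ x > 0, KSDirac.diracPotential w M lam ε x =
      (ε * lam) ^ 2 * KSDirac.superpotential w M x ^ 2 +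
        (ε * lam) * KSDirac.superpotentialDeriv w M x := fun x hx => by
    rw [hs, KSDirac.diracPotential_eq hw hM hnaked lam ε hx]
  have hV := KSDirac.continuousOn_diracPotential hw hM hnaked lam ε
  have hg : ∀ x > 0, HasDerivAt (KSDirac.superpotential w M)
      (KSDirac.superpotentialDeriv w M x) x := fun x hx =>
    KSDirac.hasDerivAt_superpotential hw hM hnaked hx
  have hg0 : ∀ x > 0, 0 < KSDirac.superpotential w M x := fun x hx =>
    KSDirac.superpotential_pos hw hM hnaked hx
  have hr : ∀ x > 0, HasDerivAt (KSDirac.radius w M)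
      ((KSDirac.superpotential w M x * KSDirac.radius w M x) ^ 2) x := fun x hx => by
    rw [KSDirac.superpotential_mul_radius_sq hw hM hnaked hx]
    exact KSDirac.hasDerivAt_radius hw hM hnaked hx
  have hr0 : ∀ x > 0, 0 < KSDirac.radius w M x := fun x hx => KSDirac.radius_pos hw hM hnaked hx
  have hgr : ∀ x > 0, KSDirac.superpotential w M x * KSDirac.radius w M x ≤ 1 := fun x hx =>
    KSDirac.superpotential_mul_radius_le_one hw hM hnaked hx
  obtain ⟨q₁, q₁', hq₁, hq₁2⟩ :=
    KSDirac.exists_zeroEnergy_not_memLp_atTop hg hg0 hr hr0 hgr (ε * lam) hVs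
  refine ⟨fun k m R₁ R₂ S₁ S₂ hR₁ hR₂ hS h => h.isSolution hw hM hnaked hε2 hR₁ hR₂ hS,
    hq₁.limitPointAtInfinity hV hq₁2, hV, fun hlam => ?_⟩
  obtain ⟨q₀, q₀', hq₀, hq₀2⟩ := KSDirac.exists_zeroEnergy_not_memLp_zero hg hg0 hr hr0 hgr
    (s := ε * lam) (by rwa [hs]) (fun x hx => KSDirac.radius_le hw hM hnaked hx) hVs
  have hd : ∀ z : ℂ, z.im ≠ 0 → ∀ u, (u, z • u) ∈
      (KSDirac.schrodingerOp (KSDirac.diracPotential w M lam ε) hV).adjoint.graph → u = 0 :=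
    fun z hz u hu => KSDirac.eq_zero_of_mem_graph_adjoint hV hq₀ hq₀2 hq₁ hq₁2 hz hu
  have hes := KSDirac.isEssentiallySelfAdjoint_of_deficiency
    (KSDirac.dense_schrodingerOp_domain hV) (KSDirac.isFormalAdjoint_schrodingerOp hV) hd
  exact ⟨hq₀.limitPointAtZero hV hq₀2, fun z hz => KSDirac.deficiencyIndex_eq_zero (hd z hz), hes,
    hes.isQuantumRegular⟩
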